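/- Let $(\Omega,\mathcal A,\mu)$ be a $\sigma$-finite measure space, and let $\mathcal L^0$ be the space of equivalence classes of a.e. finite complex-valued measurable functions on $\Omega$; $\mathcal L^p=\mathcal L^p(\Omega,\mu)\subset\mathcal L^0$ denotes the complex $L^p$-space. Let $T:\mathcal L^1\to\mathcal L^1$ be a Dunford–Schwartz operator, that is, a linear operator such that $\|T(f)\|_1\le\|f\|_1$ for all $f\in\mathcal L^1$ and $\|T(f)\|_\infty\le\|f\|_\infty$ for all $f\in\mathcal L^1\cap\mathcal L^\infty$. Let $\{\beta_k\}_{k\ge 0}\subset\mathbb C$ be a bounded Besicovitch sequence, that is, $\sup_k|\beta_k|<\infty$ and for every $\varepsilon>0$ there is a trigonometric polynomial $P(k)=\sum_{j=1}^s z_j\lambda_j^k$ ($k\in\mathbb Z$; $z_j,\lambda_j\in\mathbb C$, $|\lambda_j|=1$) such that $$\limsup_{n\to\infty}\frac1n\sum_{k=0}^{n-1}|\beta_k-P(k)|<\varepsilon .$$ Then for every $f\in\mathcal L^1$ the averages $$B_n(f)=\frac1n\sum_{k=0}^{n-1}\beta_kT^k(f)$$ converge almost uniformly, that is, there exists $g\in\mathcal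 L^0$ such that for every $\varepsilon>0$ there is a measurable set $G\subset\Omega$ with $\mu(\Omega\setminus G)\le\varepsilon$ and $\|(g-B_n(f))\chi_G\|_\infty\to0$ as $n\to\infty$. -/

import Mathlib

open MeasureTheory Filter Topology
open scoped ENNReal

/-- A linear operator `T` on (complex) `L¹(Ω, μ)` is a Dunford–Schwartz operator if it is a
contraction for the `L¹`-norm on `L¹`, and a contraction for the `L^∞`-norm on `L¹ ∩ L^∞`. -/
structure IsDunfordSchwartz {Ω : Type*} [MeasurableSpace Ω] {μ : Measure Ω}
    (T : Lp ℂ 1 μ →ₗ[ℂ] Lp ℂ 1 μ) : Prop where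
  norm_le : ∀ f : Lp ℂ 1 μ, ‖T f‖ ≤ ‖f‖
  eLpNorm_top_le : ∀ f : Lp ℂ 1 μ, MemLp f ∞ μ → eLpNorm (T f) ∞ μ ≤ eLpNorm f ∞ μ

/-- `P : ℤ → ℂ` is a trigonometric polynomial: a finite linear combination of the functions
`k ↦ λ ^ k` with `λ` on the unit circle. -/
def IsTrigPolynomial (P : ℤ → ℂ) : Prop :=
  ∃ (s : ℕ) (z : Fin s → ℂ) (l : Fin s → Circle),
    ∀ k : ℤ, P k = ∑ j : Fin s, z j * (l j : ℂ) ^ k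

/-- A bounded Besicovitch sequence: a bounded complex sequence which can be approximated by
trigonometric polynomials in the Besicovitch (upper Cesàro mean) seminorm. The means are bounded,
so that the real-valued `limsup` is the genuine one. -/
structure IsBoundedBesicovitch (β : ℕ → ℂ) : Prop where
  bounded : ∃ C : ℝ, 0 < C ∧ ∀ k, ‖β k‖ ≤ C
  approx : ∀ ε : ℝ, 0 < ε → ∃ P : ℤ → ℂ, IsTrigPolynomial P ∧
    limsup (fun n : ℕ => (1 / (n : ℝ)) * ∑ k ∈ Finset.range n, ‖β k - P (k : ℤ)‖) atTop < ε

/-- Almost uniform convergence (in Egorov's sense) of a sequence of (classes of) measurable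
functions: off a set of arbitrarily small measure the convergence takes place in the `L^∞`-norm. -/
def TendstoAU {Ω : Type*} [MeasurableSpace Ω] {μ : Measure Ω}
    (F : ℕ → Ω →ₘ[μ] ℂ) (g : Ω →ₘ[μ] ℂ) : Prop :=
  ∀ ε : ℝ, 0 < ε → ∃ G : Set Ω, MeasurableSet G ∧ μ Gᶜ ≤ ENNReal.ofReal ε ∧
    Tendsto (fun n => eLpNorm (G.indicator (fun ω => g ω - F n ω)) ∞ μ) atTop (𝓝 0)

/-- The weighted ergodic averages `B_n(f) = (1/n) ∑_{k=0}^{n-1} β_k T^k f`. -/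
noncomputable def weightedAverage {Ω : Type*} [MeasurableSpace Ω] {μ : Measure Ω}
    (T : Lp ℂ 1 μ →ₗ[ℂ] Lp ℂ 1 μ) (β : ℕ → ℂ) (n : ℕ) (f : Lp ℂ 1 μ) : Lp ℂ 1 μ :=
  (1 / (n : ℂ)) • ∑ k ∈ Finset.range n, β k • (T ^ k) f

/-! ### Vector-valued extension of an L¹ contraction. -/

section VectorValued

variable {Ω : Type*} [MeasurableSpace Ω] {μ : Measure Ω}

/-! The engine is a Banach principle. A weak type (1,1) maximal inequality for bounded weights
(`IsDunfordSchwartz.maximal`) makes the set of f whose averages are almost uniformly Cauchy closed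
in L¹, so bounded f suffice. For bounded f, replacing β by a trigonometric polynomial P changes the
averages by at most the sup bound of f times the Cesàro mean of |β - P|. Since λ^k T^k = (λT)^k and
λT is again Dunford–Schwartz, P reduces to unweighted averages A_n.

For these, T contracts the L² norm, so A_n f is Cauchy in L² by the mean ergodic theorem. A weak
type (2,2) inequality, together with the telescoping of A_j(f - A_n f), upgrades this to almost
uniform oscillation control.

T need not be positive, and no linear modulus is used. Instead, an L¹ contraction stays a
contraction on L¹ functions with values in finite-dimensional ℓ^∞ (`norm_ofCoords_map_le`).
Truncation combines this with the L^∞ bound into `IsDunfordSchwartz.lintegral_iSup_tsub_le`, which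
yields both the Hopf-type maximal inequality and the L² contraction. -/

theorem Lp.enorm_eq_lintegral {E : Type*} [NormedAddCommGroup E] (f : Lp E 1 μ) :
    ‖f‖ₑ = ∫⁻ x, ‖f x‖ₑ ∂μ := by
  rw [Lp.enorm_def, eLpNorm_one_eq_lintegral_enorm]

theorem Lp.enorm_indicatorConst_one {E : Type*} [NormedAddCommGroup E] {s : Set Ω}
    (hs : MeasurableSet s) (hμs : μ s ≠ ∞) (a : E) :
    ‖indicatorConstLp 1 hs hμs a‖ₑ = ‖a‖ₑ * μ s := by
  rw [Lp.enorm_def, eLpNorm_congr_ae indicatorConstLp_coeFn,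
    eLpNorm_indicator_const hs (by simp) (by simp)]
  simp

theorem pi_enorm_eq_iSup {ι : Type*} [Fintype ι] (v : ι → ℂ) : ‖v‖ₑ = ⨆ i, ‖v i‖ₑ := by
  apply le_antisymm
  · by_cases h : (⨆ i, ‖v i‖ₑ) = ∞
    · simp [h]
    · lift (⨆ i, ‖v i‖ₑ) to NNReal using h with c hc
      rw [enorm_le_coe, pi_nnnorm_le_iff]
      intro i
      rw [← enorm_le_coe, hc]
      exact le_iSup (fun i => ‖v i‖ₑ) i
  · refine iSup_le fun i => ?_
    simp only [enorm, ENNReal.coe_le_coe]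
    exact nnnorm_le_pi_nnnorm v i

/-- The class of `x ↦ (G i x)ᵢ`, built from the classes `G i`. -/
noncomputable def Lp.ofCoords {ι : Type*} [Fintype ι] [DecidableEq ι] (G : ι → Lp ℂ 1 μ) :
    Lp (ι → ℂ) 1 μ :=
  ∑ i, (ContinuousLinearMap.single ℂ (fun _ : ι => ℂ) i).compLpL 1 μ (G i)

theorem Lp.coeFn_finset_sum {E ι : Type*} [NormedAddCommGroup E] {p : ℝ≥0∞} (s : Finset ι)
    (f : ι → Lp E p μ) : ⇑(∑ i ∈ s, f i) =ᵐ[μ] fun x => ∑ i ∈ s, f i x := by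
  classical
  induction s using Finset.induction_on with
  | empty =>
    simp only [Finset.sum_empty]
    exact Lp.coeFn_zero E p μ
  | insert a s ha ih =>
    rw [Finset.sum_insert ha]
    filter_upwards [Lp.coeFn_add (f a) (∑ i ∈ s, f i), ih] with x h1 h2
    rw [h1, Pi.add_apply, h2, Finset.sum_insert ha]

theorem Lp.coeFn_ofCoords {ι : Type*} [Fintype ι] [DecidableEq ι] (G : ι → Lp ℂ 1 μ) :
    ∀ᵐ x ∂μ, ∀ i, Lp.ofCoords G x i = G i x := by
  have h2 : ∀ᵐ x ∂μ, ∀ i, ((ContinuousLinearMap.single ℂ (fun _ : ι => ℂ) i).compLpL 1 μ (G i)) x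
      = Pi.single i (G i x) := by
    rw [ae_all_iff]
    intro i
    exact ContinuousLinearMap.coeFn_compLpL _ _
  filter_upwards [Lp.coeFn_finset_sum Finset.univ
    (fun i => (ContinuousLinearMap.single ℂ (fun _ : ι => ℂ) i).compLpL 1 μ (G i)), h2] with x h1 h2 i
  rw [Lp.ofCoords, h1, Finset.sum_congr rfl fun j _ => h2 j, Finset.univ_sum_single]

theorem Lp.enorm_ofCoords {ι : Type*} [Fintype ι] [DecidableEq ι] (G : ι → Lp ℂ 1 μ) :
    ‖Lp.ofCoords G‖ₑ = ∫⁻ x, ⨆ i, ‖G i x‖ₑ ∂μ := by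
  rw [Lp.enorm_eq_lintegral]
  refine lintegral_congr_ae ?_
  filter_upwards [Lp.coeFn_ofCoords G] with x hx
  rw [pi_enorm_eq_iSup]
  simp_rw [hx]

/-- The vector-valued extension `T ⊗ 1` of a contraction of `L¹` is a contraction, for the sup norm
of the values. -/
theorem norm_ofCoords_map_le {ι : Type*} [Fintype ι] [DecidableEq ι]
    (T : Lp ℂ 1 μ →ₗ[ℂ] Lp ℂ 1 μ) (hT : ∀ f, ‖T f‖ ≤ ‖f‖) (F : Lp (ι → ℂ) 1 μ) :
    ‖Lp.ofCoords fun i => T ((ContinuousLinearMap.proj (R := ℂ) i).compLpL 1 μ F)‖ ≤ ‖F‖ := by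
  let T' : Lp ℂ 1 μ →L[ℂ] Lp ℂ 1 μ := T.mkContinuous 1 (by simpa using hT)
  let Φ : Lp (ι → ℂ) 1 μ →L[ℂ] Lp (ι → ℂ) 1 μ :=
    ∑ i, ((ContinuousLinearMap.single ℂ (fun _ : ι => ℂ) i).compLpL 1 μ).comp
      (T'.comp ((ContinuousLinearMap.proj (R := ℂ) i).compLpL 1 μ))
  have hΦ : ∀ F, Lp.ofCoords
      (fun i => T ((ContinuousLinearMap.proj (R := ℂ) i).compLpL 1 μ F)) = Φ F := by
    intro F
    simp only [Lp.ofCoords, Φ, _root_.sum_apply]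
    rfl
  rw [hΦ]
  -- On c·1_s the extension is c ⊗ T(1_s), whose norm factors. Norms add over disjoint supports, so
  -- the bound passes to simple functions and then to limits.
  refine Lp.induction (by simp) (motive := fun F : Lp (ι → ℂ) 1 μ => ‖Φ F‖ ≤ ‖F‖) ?_ ?_ ?_ F
  · intro c s hs hμs
    rw [Lp.simpleFunc.coe_indicatorConst, ← hΦ, ← enorm_le_iff_norm_le, Lp.enorm_ofCoords]
    set u : Lp ℂ 1 μ := indicatorConstLp 1 hs hμs.ne (1 : ℂ)
    have hproj : ∀ i, (ContinuousLinearMap.proj (R := ℂ) (φ := fun _ : ι => ℂ) i).compLpL 1 μ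
        (indicatorConstLp 1 hs hμs.ne c) = c i • u := by
      intro i
      apply Lp.ext
      filter_upwards [ContinuousLinearMap.coeFn_compLpL (p := 1) (μ := μ)
        (ContinuousLinearMap.proj (R := ℂ) (φ := fun _ : ι => ℂ) i)
        (indicatorConstLp 1 hs hμs.ne c), indicatorConstLp_coeFn (p := 1) (hs := hs)
        (hμs := hμs.ne) (c := c), indicatorConstLp_coeFn (p := 1) (hs := hs) (hμs := hμs.ne)
        (c := (1 : ℂ)), Lp.coeFn_smul (c i) u] with x h1 h2 h3 h4
      rw [h1, h2, h4, Pi.smul_apply, h3]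
      by_cases hx : x ∈ s <;> simp [hx]
    have h1 : ∫⁻ x, ⨆ i, ‖T ((ContinuousLinearMap.proj (R := ℂ) (φ := fun _ : ι => ℂ) i).compLpL 1 μ
        (indicatorConstLp 1 hs hμs.ne c)) x‖ₑ ∂μ = ∫⁻ x, ‖c‖ₑ * ‖T u x‖ₑ ∂μ := by
      refine lintegral_congr_ae ?_
      have : ∀ᵐ x ∂μ, ∀ i, (c i • T u) x = c i * T u x := by
        rw [ae_all_iff]
        intro i
        exact Lp.coeFn_smul (c i) (T u)
      filter_upwards [this] with x hx
      simp_rw [hproj, map_smul, hx, enorm_mul]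
      rw [← ENNReal.iSup_mul, pi_enorm_eq_iSup]
    rw [h1, lintegral_const_mul' _ _ enorm_ne_top, ← Lp.enorm_eq_lintegral]
    have h2 : ‖T u‖ₑ ≤ ‖u‖ₑ := enorm_le_iff_norm_le.2 (hT u)
    refine (mul_le_mul_right h2 _).trans ?_
    rw [Lp.enorm_indicatorConst_one, Lp.enorm_indicatorConst_one]
    simp
  · intro f g hf hg hd h1 h2
    rw [map_add]
    refine (norm_add_le _ _).trans ((add_le_add h1 h2).trans (le_of_eq ?_))
    rw [← MemLp.toLp_add, Lp.norm_toLp, Lp.norm_toLp, Lp.norm_toLp,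
      ← ENNReal.toReal_add hf.2.ne hg.2.ne]
    congr 1
    simp only [eLpNorm_one_eq_lintegral_enorm]
    rw [← lintegral_add_left' hf.1.enorm]
    refine lintegral_congr fun x => ?_
    by_cases hx : f x = 0
    · simp [hx]
    · have : g x = 0 := by
        by_contra hgx
        exact Set.disjoint_left.1 hd hx hgx
      simp [this]
  · exact isClosed_le (by fun_prop) (by fun_prop)

theorem lintegral_iSup_map_le_of_fintype {ι : Type*} [Fintype ι]
    (T : Lp ℂ 1 μ →ₗ[ℂ] Lp ℂ 1 μ) (hT : ∀ f, ‖T f‖ ≤ ‖f‖) (G : ι → Lp ℂ 1 μ) :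
    ∫⁻ x, ⨆ i, ‖T (G i) x‖ₑ ∂μ ≤ ∫⁻ x, ⨆ i, ‖G i x‖ₑ ∂μ := by
  classical
  have h := norm_ofCoords_map_le T hT (Lp.ofCoords G)
  have hG : ∀ i, (ContinuousLinearMap.proj (R := ℂ) (φ := fun _ : ι => ℂ) i).compLpL 1 μ
      (Lp.ofCoords G) = G i := by
    intro i
    apply Lp.ext
    filter_upwards [ContinuousLinearMap.coeFn_compLpL (p := 1) (μ := μ)
        (ContinuousLinearMap.proj (R := ℂ) (φ := fun _ : ι => ℂ) i) (Lp.ofCoords G),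
      Lp.coeFn_ofCoords G] with x h1 h2
    rw [h1, ContinuousLinearMap.proj_apply, h2]
  simp_rw [hG] at h
  rwa [← enorm_le_iff_norm_le, Lp.enorm_ofCoords, Lp.enorm_ofCoords] at h

/-- Monotone convergence along finite index sets; the applications use infinite countable families.
-/
theorem lintegral_iSup_map_le {ι : Type*} [Countable ι]
    (T : Lp ℂ 1 μ →ₗ[ℂ] Lp ℂ 1 μ) (hT : ∀ f, ‖T f‖ ≤ ‖f‖) (G : ι → Lp ℂ 1 μ) :
    ∫⁻ x, ⨆ i, ‖T (G i) x‖ₑ ∂μ ≤ ∫⁻ x, ⨆ i, ‖G i x‖ₑ ∂μ := by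
  have h1 : ∀ x, ⨆ i, ‖T (G i) x‖ₑ = ⨆ t : Finset ι, ⨆ i : t, ‖T (G i) x‖ₑ := by
    intro x
    rw [iSup_eq_iSup_finset]
    simp_rw [iSup_subtype]
  simp_rw [h1]
  rw [lintegral_iSup_directed]
  · refine iSup_le fun t => (lintegral_iSup_map_le_of_fintype T hT fun i : t => G i).trans ?_
    exact lintegral_mono fun x => iSup_le fun i => le_iSup (fun i => ‖G i x‖ₑ) (i : ι)
  · intro t
    exact AEMeasurable.iSup fun i => (Lp.aestronglyMeasurable _).enorm
  · refine Monotone.directed_le fun s t hst x => iSup_le fun i => ?_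
    exact le_iSup (fun j : t => ‖T (G j) x‖ₑ) ⟨i, hst i.2⟩

end VectorValued

/-! ### Truncation and the L² contraction. -/

section DunfordSchwartz

variable {Ω : Type*} [MeasurableSpace Ω] {μ : Measure Ω}

/-- R is the radial projection of F onto the disc of radius c, so F - R carries exactly the excess
of |F| over c. -/
theorem exists_truncation (F : Lp ℂ 1 μ) (c : NNReal) :
    ∃ R : Lp ℂ 1 μ, (∀ᵐ x ∂μ, ‖R x‖ₑ ≤ c) ∧ ∀ᵐ x ∂μ, ‖(F - R) x‖ₑ = ‖F x‖ₑ - c := by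
  let r : ℂ → ℂ := fun z => ((min 1 ((c : ℝ) / ‖z‖) : ℝ) : ℂ) * z
  have hr : Measurable r := by fun_prop
  have hr0 : ∀ z, ‖r z‖ = min 1 ((c : ℝ) / ‖z‖) * ‖z‖ := fun z => by
    have : 0 ≤ min 1 ((c : ℝ) / ‖z‖) := by positivity
    rw [norm_mul, Complex.norm_real, Real.norm_of_nonneg this]
  have hr1 : ∀ z, ‖r z‖ ≤ ‖z‖ := fun z => by
    rw [hr0]
    exact mul_le_of_le_one_left (norm_nonneg _) (min_le_left _ _)
  have hr2 : ∀ z, ‖r z‖ ≤ c := fun z => by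
    rw [hr0]
    exact (mul_le_mul_of_nonneg_right (min_le_right _ _) (norm_nonneg _)).trans
      (by rw [div_mul_eq_mul_div]; exact div_le_of_le_mul₀ (norm_nonneg _) c.2 le_rfl)
  have hr3 : ∀ z, ‖z - r z‖ = max (‖z‖ - c) 0 := fun z => by
    have h1 : z - r z = ((1 - min 1 ((c : ℝ) / ‖z‖) : ℝ) : ℂ) * z := by
      simp only [r]; push_cast; ring
    have h2 : 0 ≤ 1 - min 1 ((c : ℝ) / ‖z‖) := sub_nonneg.2 (min_le_left _ _)
    rw [h1, norm_mul, Complex.norm_real, Real.norm_of_nonneg h2]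
    rcases eq_or_ne z 0 with rfl | hz
    · simp
    have hz' : 0 < ‖z‖ := norm_pos_iff.2 hz
    rcases le_total ‖z‖ c with h | h
    · rw [min_eq_left ((one_le_div hz').2 h), max_eq_right (by linarith)]
      simp
    · rw [min_eq_right ((div_le_one hz').2 h), max_eq_left (by linarith)]
      field_simp
  have hint : Integrable (fun x => r (F x)) μ := by
    refine (L1.integrable_coeFn F).mono ?_ (Eventually.of_forall fun x => hr1 _)
    exact (hr.comp_aemeasurable (Lp.aestronglyMeasurable F).aemeasurable).aestronglyMeasurable
  refine ⟨hint.toL1 _, ?_, ?_⟩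
  · filter_upwards [hint.coeFn_toL1] with x hx
    rw [hx, enorm_le_coe]
    exact hr2 _
  · filter_upwards [hint.coeFn_toL1, Lp.coeFn_sub F (hint.toL1 _)] with x hx h2
    rw [h2, Pi.sub_apply, hx, ← ofReal_norm, hr3, ← ofReal_norm, ENNReal.ofReal_max,
      ENNReal.ofReal_sub _ c.coe_nonneg]
    simp

theorem Lp.memLp_top_of_ae_le {f : Lp ℂ 1 μ} {c : NNReal} (h : ∀ᵐ x ∂μ, ‖f x‖ₑ ≤ c) :
    MemLp f ∞ μ :=
  ⟨Lp.aestronglyMeasurable f, by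
    rw [eLpNorm_exponent_top]
    exact (essSup_le_of_ae_le _ h).trans_lt ENNReal.coe_lt_top⟩

theorem IsDunfordSchwartz.ae_le {T : Lp ℂ 1 μ →ₗ[ℂ] Lp ℂ 1 μ} (hT : IsDunfordSchwartz T)
    {f : Lp ℂ 1 μ} {c : NNReal} (h : ∀ᵐ x ∂μ, ‖f x‖ₑ ≤ c) : ∀ᵐ x ∂μ, ‖T f x‖ₑ ≤ c := by
  have h1 := hT.eLpNorm_top_le f (Lp.memLp_top_of_ae_le h)
  rw [eLpNorm_exponent_top, eLpNorm_exponent_top] at h1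
  filter_upwards [ae_le_eLpNormEssSup (f := T f) (μ := μ)] with x hx
  exact hx.trans (h1.trans (essSup_le_of_ae_le _ h))

/-- A Dunford–Schwartz operator is a contraction for the integral of a supremum of truncated
absolute values. -/
theorem IsDunfordSchwartz.lintegral_iSup_tsub_le {T : Lp ℂ 1 μ →ₗ[ℂ] Lp ℂ 1 μ}
    (hT : IsDunfordSchwartz T) {ι : Type*} [Countable ι] (F : ι → Lp ℂ 1 μ) (c : ι → NNReal) :
    ∫⁻ x, ⨆ i, (‖T (F i) x‖ₑ - c i) ∂μ ≤ ∫⁻ x, ⨆ i, (‖F i x‖ₑ - c i) ∂μ := by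
  choose R hR hFR using fun i => exists_truncation (F i) (c i)
  -- The L^∞ contraction gives |T R_i| ≤ c_i, which the subtraction absorbs; the remainder T(F_i -
  -- R_i) falls under the L¹ estimate.
  calc ∫⁻ x, ⨆ i, (‖T (F i) x‖ₑ - c i) ∂μ
      ≤ ∫⁻ x, ⨆ i, ‖T (F i - R i) x‖ₑ ∂μ := by
        refine lintegral_mono_ae ?_
        have h1 : ∀ᵐ x ∂μ, ∀ i, ‖T (R i) x‖ₑ ≤ c i := ae_all_iff.2 fun i => hT.ae_le (hR i)
        have h2 : ∀ᵐ x ∂μ, ∀ i, T (F i - R i) x = T (F i) x - T (R i) x := by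
          refine ae_all_iff.2 fun i => ?_
          rw [map_sub]
          exact Lp.coeFn_sub _ _
        filter_upwards [h1, h2] with x h1 h2
        refine iSup_mono fun i => tsub_le_iff_right.2 ?_
        calc ‖T (F i) x‖ₑ = ‖T (F i - R i) x + T (R i) x‖ₑ := by rw [h2, sub_add_cancel]
          _ ≤ ‖T (F i - R i) x‖ₑ + ‖T (R i) x‖ₑ := enorm_add_le _ _
          _ ≤ _ := by gcongr; exact h1 i
    _ ≤ ∫⁻ x, ⨆ i, ‖(F i - R i) x‖ₑ ∂μ := lintegral_iSup_map_le T hT.norm_le _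
    _ = ∫⁻ x, ⨆ i, (‖F i x‖ₑ - c i) ∂μ := by
        refine lintegral_congr_ae ?_
        filter_upwards [ae_all_iff.2 hFR] with x hx
        simp_rw [hx]

/-- Legendre duality: a² - (2ta - t²) = (a - t)², and rational t come arbitrarily close to a. -/
theorem iSup_rat_mul_tsub_sq (a : NNReal) :
    ⨆ t : ℚ≥0, (((2 * t : NNReal) * a : ℝ≥0∞) - ((t : NNReal) ^ 2 : NNReal)) = (a : ℝ≥0∞) ^ 2 := by
  apply le_antisymm
  · refine iSup_le fun t => tsub_le_iff_right.2 ?_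
    norm_cast
    rw [← NNReal.coe_le_coe]
    push_cast
    nlinarith [sq_nonneg ((a : ℝ) - (t : NNReal))]
  · refine le_of_forall_lt fun b hb => ?_
    have hb' : b ≠ ∞ := (hb.trans_le le_top).ne
    lift b to NNReal using hb'
    have hb2 : b < a ^ 2 := by exact_mod_cast hb
    obtain ⟨d, hd, hd1⟩ : ∃ d : ℝ, 0 < d ∧ d ^ 2 < a ^ 2 - b := by
      have h : (0 : ℝ) < a ^ 2 - b := by
        have : (b : ℝ) < a ^ 2 := by exact_mod_cast hb2
        linarith
      refine ⟨Real.sqrt ((a ^ 2 - b) / 2), by positivity, ?_⟩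
      rw [Real.sq_sqrt (by positivity)]
      linarith
    obtain ⟨q, hq1, hq2⟩ := exists_rat_btwn (show (a : ℝ) < a + d by linarith)
    have hq0 : 0 ≤ q := by
      have : (0 : ℝ) ≤ q := a.2.trans hq1.le
      exact_mod_cast this
    lift q to ℚ≥0 using hq0
    refine lt_of_lt_of_le ?_ (le_iSup _ q)
    norm_cast
    rw [← NNReal.coe_lt_coe, NNReal.coe_sub_def]
    have hq : (((q : ℚ) : ℝ)) = ((q : NNReal) : ℝ) := by simp; rfl
    rw [hq] at hq1 hq2
    push_cast
    refine lt_max_of_lt_left ?_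
    have h1 : ((q : NNReal) - a : ℝ) ^ 2 < d ^ 2 := by
      apply pow_lt_pow_left₀ <;> linarith
    nlinarith

/-- By duality |f|² is the supremum over rational t of |2t f| - t², so no interpolation theorem is
needed: this is the truncated-supremum inequality for the family 2t f with levels t². -/
theorem IsDunfordSchwartz.lintegral_sq_le {T : Lp ℂ 1 μ →ₗ[ℂ] Lp ℂ 1 μ}
    (hT : IsDunfordSchwartz T) (f : Lp ℂ 1 μ) :
    ∫⁻ x, ‖T f x‖ₑ ^ 2 ∂μ ≤ ∫⁻ x, ‖f x‖ₑ ^ 2 ∂μ := by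
  have key : ∀ g : Lp ℂ 1 μ, ∀ᵐ x ∂μ, ∀ t : ℚ≥0,
      ‖(((2 * t : ℝ) : ℂ) • g) x‖ₑ = ((2 * t : NNReal) * ‖g x‖₊ : ℝ≥0∞) := by
    refine fun g => ae_all_iff.2 fun t => ?_
    filter_upwards [Lp.coeFn_smul ((2 * t : ℝ) : ℂ) g] with x hx
    rw [hx, Pi.smul_apply, enorm_smul, enorm_eq_nnnorm (g x)]
    congr 1
    rw [enorm_eq_nnnorm, ENNReal.coe_inj, ← NNReal.coe_inj]
    simp
  have h := hT.lintegral_iSup_tsub_le (fun t : ℚ≥0 => ((2 * t : ℝ) : ℂ) • f)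
    (fun t => (t : NNReal) ^ 2)
  have key2 : ∀ g : Lp ℂ 1 μ, ∫⁻ x, ⨆ t : ℚ≥0,
      (‖(((2 * t : ℝ) : ℂ) • g) x‖ₑ - ((t : NNReal) ^ 2 : NNReal)) ∂μ = ∫⁻ x, ‖g x‖ₑ ^ 2 ∂μ := by
    intro g
    refine lintegral_congr_ae ?_
    filter_upwards [key g] with x hx
    simp_rw [hx]
    exact iSup_rat_mul_tsub_sq _
  simp_rw [map_smul] at h
  rwa [key2, key2] at h

theorem IsDunfordSchwartz.smul {T : Lp ℂ 1 μ →ₗ[ℂ] Lp ℂ 1 μ} (hT : IsDunfordSchwartz T)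
    {c : ℂ} (hc : ‖c‖ = 1) : IsDunfordSchwartz (c • T) where
  norm_le f := by
    rw [LinearMap.smul_apply, norm_smul, hc, one_mul]
    exact hT.norm_le f
  eLpNorm_top_le f hf := by
    rw [LinearMap.smul_apply, eLpNorm_congr_ae (Lp.coeFn_smul c (T f)), eLpNorm_const_smul]
    rw [← ofReal_norm, hc, ENNReal.ofReal_one, one_mul]
    exact hT.eLpNorm_top_le f hf

theorem IsDunfordSchwartz.pow_ae_le {T : Lp ℂ 1 μ →ₗ[ℂ] Lp ℂ 1 μ} (hT : IsDunfordSchwartz T)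
    {f : Lp ℂ 1 μ} {c : NNReal} (h : ∀ᵐ x ∂μ, ‖f x‖ₑ ≤ c) (k : ℕ) :
    ∀ᵐ x ∂μ, ‖(T ^ k) f x‖ₑ ≤ c := by
  induction k with
  | zero => simpa using h
  | succ k ih =>
    rw [pow_succ', Module.End.mul_apply]
    exact hT.ae_le ih

end DunfordSchwartz

/-! ### Maximal inequalities of weak type (1,1) and (2,2). -/

section Maximal

variable {Ω : Type*} [MeasurableSpace Ω] {μ : Measure Ω}

/-- The weighted ergodic sum `∑_{j<k} β_j T^j f`. -/
noncomputable def weightedSum (T : Lp ℂ 1 μ →ₗ[ℂ] Lp ℂ 1 μ) (β : ℕ → ℂ) (k : ℕ) (f : Lp ℂ 1 μ) :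
    Lp ℂ 1 μ :=
  ∑ j ∈ Finset.range k, β j • (T ^ j) f

theorem weightedSum_succ' (T : Lp ℂ 1 μ →ₗ[ℂ] Lp ℂ 1 μ) (β : ℕ → ℂ) (k : ℕ) (f : Lp ℂ 1 μ) :
    weightedSum T β (k + 1) f = β 0 • f + T (weightedSum T (fun j => β (j + 1)) k f) := by
  simp only [weightedSum, Finset.sum_range_succ', map_sum, map_smul, pow_succ', pow_zero,
    Module.End.mul_apply, Module.End.one_apply]
  rw [add_comm]

theorem coeFn_weightedSum (T : Lp ℂ 1 μ →ₗ[ℂ] Lp ℂ 1 μ) (β : ℕ → ℂ) (k : ℕ) (f : Lp ℂ 1 μ) :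
    ∀ᵐ x ∂μ, weightedSum T β k f x = ∑ j ∈ Finset.range k, β j * (T ^ j) f x := by
  have h : ∀ᵐ x ∂μ, ∀ j, (β j • (T ^ j) f) x = β j * (T ^ j) f x :=
    ae_all_iff.2 fun j => Lp.coeFn_smul (β j) ((T ^ j) f)
  filter_upwards [Lp.coeFn_finset_sum (Finset.range k) (fun j => β j • (T ^ j) f), h]
    with x h1 h2
  rw [weightedSum, h1]
  exact Finset.sum_congr rfl fun j _ => h2 j

/-- Hopf's argument. With h the supremum of the excesses |S| - kl and Q the same supremum for TS,
one has h + l ≤ |f| + Q wherever h > 0. Since ∫ Q ≤ ∫ h, integrating and cancelling ∫ h leaves the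
claim. -/
theorem IsDunfordSchwartz.maximal_aux {T : Lp ℂ 1 μ →ₗ[ℂ] Lp ℂ 1 μ}
    (hT : IsDunfordSchwartz T) {β : ℕ → ℂ} (hβ : ∀ k, ‖β k‖ ≤ 1) (f : Lp ℂ 1 μ) (l : NNReal)
    (N : ℕ) :
    l * μ {x | ∃ k ≤ N, (k * l : NNReal) < ‖weightedSum T β k f x‖ₑ} ≤ ∫⁻ x, ‖f x‖ₑ ∂μ := by
  -- All shifts of the weights are included, because peeling off the first term of a sum shifts them
  -- by one. Bounding the length by N keeps h integrable, as the final cancellation requires.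
  let S : ℕ × Fin (N + 1) → Lp ℂ 1 μ := fun p => weightedSum T (fun j => β (p.1 + j)) p.2 f
  let c : ℕ × Fin (N + 1) → NNReal := fun p => (p.2 : ℕ) * l
  let h : Ω → ℝ≥0∞ := fun x => ⨆ p, (‖S p x‖ₑ - c p)
  let Q : Ω → ℝ≥0∞ := fun x => ⨆ p, (‖T (S p) x‖ₑ - c p)
  have hβ' : ∀ k, ‖β k‖ₑ ≤ 1 := fun k => by simpa using enorm_le_coe.2 (show ‖β k‖₊ ≤ 1 from hβ k)
  have hQh : ∫⁻ x, Q x ∂μ ≤ ∫⁻ x, h x ∂μ := hT.lintegral_iSup_tsub_le S c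
  have hhm : AEMeasurable h μ :=
    AEMeasurable.iSup fun p => (Lp.aestronglyMeasurable _).enorm.sub_const _
  have hfm : AEMeasurable (fun x => ‖f x‖ₑ) μ := (Lp.aestronglyMeasurable _).enorm
  have hhfin : ∫⁻ x, h x ∂μ ≠ ∞ := by
    have h1 : ∀ᵐ x ∂μ, h x ≤ ∑ j ∈ Finset.range (N + 1), ‖(T ^ j) f x‖ₑ := by
      have h2 : ∀ᵐ x ∂μ, ∀ p, S p x
          = ∑ j ∈ Finset.range p.2, β (p.1 + j) * (T ^ j) f x :=
        ae_all_iff.2 fun p => coeFn_weightedSum T _ _ f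
      filter_upwards [h2] with x hx
      refine iSup_le fun p => tsub_le_self.trans ?_
      rw [hx]
      refine (enorm_sum_le _ _).trans ?_
      calc ∑ j ∈ Finset.range p.2, ‖β (p.1 + j) * (T ^ j) f x‖ₑ
          ≤ ∑ j ∈ Finset.range p.2, ‖(T ^ j) f x‖ₑ := by
            refine Finset.sum_le_sum fun j _ => ?_
            rw [enorm_mul]
            exact mul_le_of_le_one_left zero_le (hβ' _)
        _ ≤ _ := Finset.sum_le_sum_of_subset (Finset.range_mono p.2.2.le)
    refine ((lintegral_mono_ae h1).trans_lt ?_).ne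
    rw [lintegral_finsetSum' _ fun j _ => (Lp.aestronglyMeasurable _).enorm]
    refine ENNReal.sum_lt_top.2 fun j _ => ?_
    rw [← Lp.enorm_eq_lintegral]
    exact enorm_lt_top
  have hpt : ∀ᵐ x ∂μ, x ∈ {x | 0 < h x} → h x + l ≤ ‖f x‖ₑ + Q x := by
    have h3 : ∀ᵐ x ∂μ, ∀ (i : ℕ) (k : ℕ), weightedSum T (fun j => β (i + j)) (k + 1) f x
        = β i * f x + T (weightedSum T (fun j => β (i + 1 + j)) k f) x := by
      refine ae_all_iff.2 fun i => ae_all_iff.2 fun k => ?_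
      have e : (fun j => β (i + (j + 1))) = fun j => β (i + 1 + j) := by
        funext j; congr 1; ring
      rw [weightedSum_succ', e]
      filter_upwards [Lp.coeFn_add (β (i + 0) • f)
        (T (weightedSum T (fun j => β (i + 1 + j)) k f)), Lp.coeFn_smul (β (i + 0)) f]
        with x h1 h2
      rw [h1, Pi.add_apply, h2]
      rfl
    have h4 : ∀ᵐ x ∂μ, ∀ i : ℕ, weightedSum T (fun j => β (i + j)) 0 f x = 0 := by
      refine ae_all_iff.2 fun i => ?_
      filter_upwards [coeFn_weightedSum T (fun j => β (i + j)) 0 f] with x hx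
      simpa using hx
    filter_upwards [h3, h4] with x hx hx0 hpos
    have hterm : ∀ p, 0 < ‖S p x‖ₑ - c p → ‖S p x‖ₑ - c p + l ≤ ‖f x‖ₑ + Q x := by
      rintro ⟨i, k, hk⟩ hp
      rcases k with _ | k
      · simp [S, hx0] at hp
      -- Shortening the sum by one term lowers its level from (k+1)l to kl; this releases the extra
      -- l.
      have hcp : ((c ⟨i, ⟨k + 1, hk⟩⟩ : NNReal) : ℝ≥0∞) = ((k * l : NNReal) : ℝ≥0∞) + l := by
        simp only [c]; push_cast; ring
      have hlt := tsub_pos_iff_lt.1 hp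
      rw [hcp] at hlt ⊢
      rw [← tsub_tsub, tsub_add_cancel_of_le (ENNReal.le_sub_of_add_le_left ENNReal.coe_ne_top hlt.le)]
      have hS : ‖S ⟨i, ⟨k + 1, hk⟩⟩ x‖ₑ ≤ ‖f x‖ₑ + ‖T (S ⟨i + 1, ⟨k, by omega⟩⟩) x‖ₑ := by
        simp only [S, hx]
        refine (enorm_add_le _ _).trans ?_
        gcongr
        rw [enorm_mul]
        exact mul_le_of_le_one_left zero_le (hβ' _)
      refine (tsub_le_tsub_right hS _).trans (add_tsub_le_assoc.trans ?_)
      gcongr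
      exact le_iSup (fun p => ‖T (S p) x‖ₑ - c p) ⟨i + 1, ⟨k, by omega⟩⟩
    obtain ⟨p₀, hp₀⟩ := lt_iSup_iff.1 (show 0 < ⨆ p, (‖S p x‖ₑ - c p) from hpos)
    simp only [h]
    rw [ENNReal.iSup_add]
    refine iSup_le fun p => ?_
    -- Indices with zero excess are dominated through `p₀`, whose excess is positive.
    rcases eq_or_ne (‖S p x‖ₑ - c p) 0 with h0 | h0
    · rw [h0]
      exact (add_le_add_left hp₀.le _).trans (hterm p₀ hp₀)
    · exact hterm p (pos_iff_ne_zero.2 h0)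
  have hE : NullMeasurableSet {x | 0 < h x} μ := nullMeasurableSet_lt aemeasurable_const hhm
  have hEint : ∫⁻ x in {x | 0 < h x}, h x ∂μ = ∫⁻ x, h x ∂μ := by
    rw [← lintegral_indicator₀ hE]
    refine lintegral_congr fun x => ?_
    by_cases hx : 0 < h x
    · exact Set.indicator_of_mem (s := {x | 0 < h x}) hx _
    · rw [Set.indicator_of_notMem (s := {x | 0 < h x}) hx]
      exact (nonpos_iff_eq_zero.1 (not_lt.1 hx)).symm
  have hmain : ∫⁻ x, h x ∂μ + l * μ {x | 0 < h x} ≤ ∫⁻ x, h x ∂μ + ∫⁻ x, ‖f x‖ₑ ∂μ := by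
    calc ∫⁻ x, h x ∂μ + l * μ {x | 0 < h x}
        = ∫⁻ x in {x | 0 < h x}, (h x + l) ∂μ := by
          rw [lintegral_add_left' hhm.restrict, hEint, setLIntegral_const]
      _ ≤ ∫⁻ x in {x | 0 < h x}, (‖f x‖ₑ + Q x) ∂μ := by
          refine lintegral_mono_ae ?_
          rw [ae_restrict_iff'₀ hE]
          exact hpt
      _ ≤ ∫⁻ x, (‖f x‖ₑ + Q x) ∂μ := setLIntegral_le_lintegral _ _
      _ = ∫⁻ x, ‖f x‖ₑ ∂μ + ∫⁻ x, Q x ∂μ := lintegral_add_left' hfm _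
      _ ≤ _ := by rw [add_comm]; gcongr
  have hmain' := (ENNReal.add_le_add_iff_left hhfin).1 hmain
  refine le_trans ?_ hmain'
  gcongr
  rintro ⟨k, hk, hx⟩
  refine lt_of_lt_of_le (tsub_pos_iff_lt.2 hx) ?_
  have e : S (0, ⟨k, Nat.lt_succ_of_le hk⟩) = weightedSum T β k f := by simp only [S, zero_add]
  rw [← e]
  exact le_iSup (fun p => ‖S p x‖ₑ - c p) (0, ⟨k, Nat.lt_succ_of_le hk⟩)

/-- The weak type `(1, 1)` maximal inequality for weighted ergodic sums. -/
theorem IsDunfordSchwartz.maximal {T : Lp ℂ 1 μ →ₗ[ℂ] Lp ℂ 1 μ}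
    (hT : IsDunfordSchwartz T) {β : ℕ → ℂ} (hβ : ∀ k, ‖β k‖ ≤ 1) (f : Lp ℂ 1 μ) (l : NNReal) :
    l * μ {x | ∃ k : ℕ, (k * l : NNReal) < ‖weightedSum T β k f x‖ₑ} ≤ ∫⁻ x, ‖f x‖ₑ ∂μ := by
  have h1 : {x | ∃ k : ℕ, (k * l : NNReal) < ‖weightedSum T β k f x‖ₑ}
      = ⋃ N : ℕ, {x | ∃ k ≤ N, (k * l : NNReal) < ‖weightedSum T β k f x‖ₑ} := by
    ext x
    simp only [Set.mem_ofPred_eq, Set.mem_iUnion]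
    exact ⟨fun ⟨k, hk⟩ => ⟨k, k, le_rfl, hk⟩, fun ⟨_, k, _, hk⟩ => ⟨k, hk⟩⟩
  rw [h1, Monotone.measure_iUnion, ENNReal.mul_iSup]
  · exact iSup_le fun N => hT.maximal_aux hβ f l N
  · exact fun M N hMN x ⟨k, hk, hx⟩ => ⟨k, hk.trans hMN, hx⟩

theorem IsDunfordSchwartz.weightedSum_ae_le {T : Lp ℂ 1 μ →ₗ[ℂ] Lp ℂ 1 μ}
    (hT : IsDunfordSchwartz T) (β : ℕ → ℂ) {f : Lp ℂ 1 μ} {c : NNReal}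
    (hf : ∀ᵐ x ∂μ, ‖f x‖ₑ ≤ c) :
    ∀ᵐ x ∂μ, ∀ k, ‖weightedSum T β k f x‖ ≤ (∑ j ∈ Finset.range k, ‖β j‖) * c := by
  refine ae_all_iff.2 fun k => ?_
  filter_upwards [coeFn_weightedSum T β k f, ae_all_iff.2 fun j => hT.pow_ae_le hf j]
    with x hx h
  rw [hx, Finset.sum_mul]
  refine norm_sum_le_of_le _ fun j _ => ?_
  rw [norm_mul]
  gcongr
  exact enorm_le_coe.1 (h j)

theorem weightedSum_sub (T : Lp ℂ 1 μ →ₗ[ℂ] Lp ℂ 1 μ) (β : ℕ → ℂ) (k : ℕ) (f g : Lp ℂ 1 μ) :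
    weightedSum T β k (f - g) = weightedSum T β k f - weightedSum T β k g := by
  simp [weightedSum, smul_sub]

/-- The weak type `(2, 2)` maximal inequality for weighted ergodic sums. -/
theorem IsDunfordSchwartz.maximal_sq {T : Lp ℂ 1 μ →ₗ[ℂ] Lp ℂ 1 μ}
    (hT : IsDunfordSchwartz T) {β : ℕ → ℂ} (hβ : ∀ k, ‖β k‖ ≤ 1) (f : Lp ℂ 1 μ) (l : NNReal) :
    l ^ 2 * μ {x | ∃ k : ℕ, k * (2 * l : ℝ) < ‖weightedSum T β k f x‖}
      ≤ ∫⁻ x, ‖f x‖ₑ ^ 2 ∂μ := by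
  -- The sums of R are at most kl, so exceeding 2kl forces the sums of f - R above kl. The weak
  -- (1,1) bound then applies, and l(|f| - l)⁺ ≤ |f|².
  obtain ⟨R, hR, hG⟩ := exists_truncation f l
  have h1 : μ {x | ∃ k : ℕ, k * (2 * l : ℝ) < ‖weightedSum T β k f x‖}
      ≤ μ {x | ∃ k : ℕ, (k * l : NNReal) < ‖weightedSum T β k (f - R) x‖ₑ} := by
    refine measure_mono_ae ?_
    have h2 : ∀ᵐ x ∂μ, ∀ k, weightedSum T β k (f - R) x
        = weightedSum T β k f x - weightedSum T β k R x := by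
      refine ae_all_iff.2 fun k => ?_
      rw [weightedSum_sub]
      exact Lp.coeFn_sub _ _
    filter_upwards [h2, hT.weightedSum_ae_le β hR] with x h2 h3
    rintro ⟨k, hk⟩
    refine ⟨k, ?_⟩
    have h4 : ‖weightedSum T β k R x‖ ≤ k * l := by
      refine (h3 k).trans ?_
      gcongr
      exact (Finset.sum_le_sum fun j _ => hβ j).trans (by simp)
    have h5 := norm_sub_norm_le (weightedSum T β k f x) (weightedSum T β k R x)
    rw [enorm_eq_nnnorm, ENNReal.coe_lt_coe, ← NNReal.coe_lt_coe, coe_nnnorm, h2]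
    push_cast
    linarith
  calc (l : ℝ≥0∞) ^ 2 * μ {x | ∃ k : ℕ, k * (2 * l : ℝ) < ‖weightedSum T β k f x‖}
      ≤ l * (l * μ {x | ∃ k : ℕ, (k * l : NNReal) < ‖weightedSum T β k (f - R) x‖ₑ}) := by
        rw [sq, mul_assoc]
        gcongr
    _ ≤ l * ∫⁻ x, ‖(f - R) x‖ₑ ∂μ := by
        gcongr
        exact hT.maximal hβ _ l
    _ = ∫⁻ x, l * ‖(f - R) x‖ₑ ∂μ := (lintegral_const_mul' _ _ ENNReal.coe_ne_top).symm
    _ ≤ ∫⁻ x, ‖f x‖ₑ ^ 2 ∂μ := by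
        refine lintegral_mono_ae ?_
        filter_upwards [hG] with x hx
        rw [hx, sq]
        rcases le_total ‖f x‖ₑ l with h | h
        · simp [tsub_eq_zero_of_le h]
        · exact mul_le_mul' h tsub_le_self

end Maximal

/-! ### Mean ergodic theorem for a Hilbertian seminorm. -/

section MeanErgodic

variable {V H : Type*} [AddCommGroup V] [Module ℂ V]

/-- The ergodic averages of a linear operator. -/
noncomputable def ergodicAvg (S : V →ₗ[ℂ] V) (n : ℕ) : V →ₗ[ℂ] V :=
  (n : ℂ)⁻¹ • ∑ k ∈ Finset.range n, S ^ k

theorem ergodicAvg_apply (S : V →ₗ[ℂ] V) (n : ℕ) (v : V) :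
    ergodicAvg S n v = (n : ℂ)⁻¹ • ∑ k ∈ Finset.range n, (S ^ k) v := by
  simp [ergodicAvg]

theorem sum_pow_sub_pow_succ (S : V →ₗ[ℂ] V) (n : ℕ) (v : V) :
    ∑ k ∈ Finset.range n, (S ^ k) (v - S v) = v - (S ^ n) v := by
  induction n with
  | zero => simp
  | succ n ih =>
    rw [Finset.sum_range_succ, ih, map_sub, pow_succ, Module.End.mul_apply]
    abel

theorem ergodicAvg_sub_map (S : V →ₗ[ℂ] V) (n : ℕ) (v : V) :
    ergodicAvg S n (v - S v) = (n : ℂ)⁻¹ • (v - (S ^ n) v) := by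
  rw [ergodicAvg_apply, sum_pow_sub_pow_succ]

variable [NormedAddCommGroup H] [InnerProductSpace ℂ H]
  {J : V →ₗ[ℂ] H} {S : V →ₗ[ℂ] V}

theorem norm_map_pow_le (hS : ∀ v, ‖J (S v)‖ ≤ ‖J v‖) (k : ℕ) (v : V) :
    ‖J ((S ^ k) v)‖ ≤ ‖J v‖ := by
  induction k with
  | zero => simp
  | succ k ih =>
    rw [pow_succ', Module.End.mul_apply]
    exact (hS _).trans ih

theorem norm_map_ergodicAvg_le (hS : ∀ v, ‖J (S v)‖ ≤ ‖J v‖) (n : ℕ) (v : V) :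
    ‖J (ergodicAvg S n v)‖ ≤ ‖J v‖ := by
  rcases Nat.eq_zero_or_pos n with rfl | hn
  · simp [ergodicAvg]
  rw [ergodicAvg_apply, map_smul, map_sum, norm_smul, norm_inv, Complex.norm_natCast,
    inv_mul_le_iff₀ (by positivity)]
  refine (norm_sum_le_of_le _ fun k _ => norm_map_pow_le hS k v).trans ?_
  simp

theorem tendsto_norm_map_ergodicAvg_sub_map (hS : ∀ v, ‖J (S v)‖ ≤ ‖J v‖) (v : V) :
    Tendsto (fun n => ‖J (ergodicAvg S n (v - S v))‖) atTop (𝓝 0) := by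
  refine squeeze_zero (fun _ => norm_nonneg _) (g := fun n : ℕ => (2 * ‖J v‖) / n) (fun n => ?_)
    (tendsto_const_div_atTop_nhds_zero_nat _)
  rw [ergodicAvg_sub_map, map_smul, norm_smul, norm_inv, Complex.norm_natCast, map_sub,
    div_eq_inv_mul]
  gcongr
  refine (norm_sub_le _ _).trans ?_
  linarith [norm_map_pow_le hS n v]

/-- The vectors whose ergodic averages are asymptotic to those of `x`. -/
def asymptoticClass (J : V →ₗ[ℂ] H) (S : V →ₗ[ℂ] V) (x : V) : Set V :=
  {y | Tendsto (fun n => ‖J (ergodicAvg S n (x - y))‖) atTop (𝓝 0)}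

theorem map_mem_asymptoticClass (hS : ∀ v, ‖J (S v)‖ ≤ ‖J v‖) {x y : V}
    (hy : y ∈ asymptoticClass J S x) : S y ∈ asymptoticClass J S x := by
  have h := (show Tendsto _ _ _ from hy).add (tendsto_norm_map_ergodicAvg_sub_map hS y)
  rw [add_zero] at h
  refine squeeze_zero (fun _ => norm_nonneg _) (fun n => ?_) h
  have e : x - S y = (x - y) + (y - S y) := by abel
  rw [e, map_add, map_add]
  exact norm_add_le _ _

theorem pow_mem_asymptoticClass (hS : ∀ v, ‖J (S v)‖ ≤ ‖J v‖) {x y : V}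
    (hy : y ∈ asymptoticClass J S x) (k : ℕ) : (S ^ k) y ∈ asymptoticClass J S x := by
  induction k with
  | zero => simpa using hy
  | succ k ih =>
    rw [pow_succ', Module.End.mul_apply]
    exact map_mem_asymptoticClass hS ih

/-- Convexity of the class; with invariance under S it puts every average of positive length of a
member back in the class. -/
theorem average_mem_asymptoticClass {x : V} {n : ℕ} (hn : 0 < n) {y : ℕ → V}
    (hy : ∀ k, y k ∈ asymptoticClass J S x) :
    (n : ℂ)⁻¹ • ∑ k ∈ Finset.range n, y k ∈ asymptoticClass J S x := by
  have h : Tendsto (fun m => (n : ℝ)⁻¹ * ∑ k ∈ Finset.range n,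
      ‖J (ergodicAvg S m (x - y k))‖) atTop (𝓝 ((n : ℝ)⁻¹ * ∑ k ∈ Finset.range n, (0 : ℝ))) :=
    (tendsto_finsetSum _ fun k _ => hy k).const_mul _
  rw [Finset.sum_const_zero, mul_zero] at h
  refine squeeze_zero (fun _ => norm_nonneg _) (fun m => ?_) h
  have e : x - (n : ℂ)⁻¹ • ∑ k ∈ Finset.range n, y k
      = (n : ℂ)⁻¹ • ∑ k ∈ Finset.range n, (x - y k) := by
    have hn' : (n : ℂ) ≠ 0 := by exact_mod_cast hn.ne'
    rw [Finset.sum_sub_distrib, smul_sub, Finset.sum_const, Finset.card_range,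
      ← Nat.cast_smul_eq_nsmul ℂ, inv_smul_smul₀ hn']
  rw [e, map_smul, map_smul, norm_smul, norm_inv, Complex.norm_natCast, map_sum, map_sum]
  gcongr
  exact norm_sum_le _ _

/-- The mean ergodic theorem, for an operator that is contractive with respect to a Hilbertian
seminorm `v ↦ ‖J v‖`: the averages are Cauchy. -/
theorem cauchySeq_map_ergodicAvg (hS : ∀ v, ‖J (S v)‖ ≤ ‖J v‖) (x : V) :
    CauchySeq fun n => J (ergodicAvg S n x) := by
  -- Riesz's argument without completeness: for an almost norm-minimal y in this convex class, all
  -- averages of y are almost minimal too, hence mutually close by the parallelogram law. The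
  -- averages of x follow those of y.
  set C := asymptoticClass J S x with hC
  have hxC : x ∈ C := by simp [hC, asymptoticClass]
  set d := sInf ((fun y => ‖J y‖) '' C) with hd
  have hbdd : BddBelow ((fun y => ‖J y‖) '' C) :=
    ⟨0, by rintro _ ⟨y, _, rfl⟩; exact norm_nonneg _⟩
  have hd0 : 0 ≤ d := Real.sInf_nonneg (by rintro _ ⟨y, _, rfl⟩; exact norm_nonneg _)
  rw [Metric.cauchySeq_iff]
  intro ε hε
  -- The parallelogram law bounds ‖Ja - Jb‖² by this difference when both norms are at most d + δ
  -- and the midpoint has norm at least d.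
  obtain ⟨δ, hδ, hδ1⟩ : ∃ δ : ℝ, 0 < δ ∧ 4 * (d + δ) ^ 2 - 4 * d ^ 2 < (ε / 3) ^ 2 := by
    have hcont : Tendsto (fun δ : ℝ => 4 * (d + δ) ^ 2 - 4 * d ^ 2) (𝓝[>] 0) (𝓝 0) := by
      have : Continuous fun δ : ℝ => 4 * (d + δ) ^ 2 - 4 * d ^ 2 := by fun_prop
      have h := this.tendsto 0
      simp only [add_zero, sub_self] at h
      exact h.mono_left nhdsWithin_le_nhds
    have h1 := hcont.eventually_lt_const (show (0 : ℝ) < (ε / 3) ^ 2 by positivity)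
    obtain ⟨δ, h2, h3⟩ := (h1.and self_mem_nhdsWithin).exists
    exact ⟨δ, h3, h2⟩
  obtain ⟨_, ⟨y, hyC, rfl⟩, hy⟩ := exists_lt_of_csInf_lt (⟨_, x, hxC, rfl⟩ :
    ((fun y => ‖J y‖) '' C).Nonempty) (show d < d + δ by linarith)
  have hclose : ∀ n > 0, ∀ m > 0,
      ‖J (ergodicAvg S n y) - J (ergodicAvg S m y)‖ < ε / 3 := by
    intro n hn m hm
    set a := ergodicAvg S n y with ha
    set b := ergodicAvg S m y with hb
    have haC : a ∈ C := by
      rw [ha, ergodicAvg_apply]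
      exact average_mem_asymptoticClass hn fun k => pow_mem_asymptoticClass hS hyC k
    have hbC : b ∈ C := by
      rw [hb, ergodicAvg_apply]
      exact average_mem_asymptoticClass hm fun k => pow_mem_asymptoticClass hS hyC k
    have hmid : ((2 : ℕ) : ℂ)⁻¹ • (a + b) ∈ C := by
      have := average_mem_asymptoticClass (J := J) (S := S) (x := x) (n := 2) (by norm_num)
        (y := fun k => if k = 0 then a else b) (fun k => by split_ifs <;> assumption)
      simpa [Finset.sum_range_succ] using this
    have h1 : d ≤ 2⁻¹ * ‖J a + J b‖ := by
      have := csInf_le hbdd ⟨_, hmid, rfl⟩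
      dsimp only at this
      rw [map_smul, norm_smul, map_add] at this
      simpa using this
    have h2 : ‖J a‖ ≤ d + δ := (norm_map_ergodicAvg_le hS n y).trans hy.le
    have h3 : ‖J b‖ ≤ d + δ := (norm_map_ergodicAvg_le hS m y).trans hy.le
    have h4 := parallelogram_law_with_norm ℂ (J a) (J b)
    refine lt_of_pow_lt_pow_left₀ 2 (by positivity) (lt_of_le_of_lt ?_ hδ1)
    have h5 : ‖J a‖ ^ 2 ≤ (d + δ) ^ 2 := pow_le_pow_left₀ (norm_nonneg _) h2 2
    have h6 : ‖J b‖ ^ 2 ≤ (d + δ) ^ 2 := pow_le_pow_left₀ (norm_nonneg _) h3 2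
    have h7 : (2 * d) ^ 2 ≤ ‖J a + J b‖ ^ 2 := pow_le_pow_left₀ (by positivity) (by linarith) 2
    nlinarith
  have hy' : Tendsto (fun n => ‖J (ergodicAvg S n (x - y))‖) atTop (𝓝 0) := hyC
  obtain ⟨N, hN⟩ := eventually_atTop.1
    ((hy'.eventually_lt_const (show (0 : ℝ) < ε / 3 by positivity)).and (eventually_gt_atTop 0))
  refine ⟨N, fun n hn m hm => ?_⟩
  rw [dist_eq_norm]
  have h1 := (hN n hn).1
  have h2 := (hN m hm).1
  have h3 := hclose n (hN n hn).2 m (hN m hm).2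
  rw [map_sub, map_sub] at h1 h2
  have e : J (ergodicAvg S n x) - J (ergodicAvg S m x)
      = (J (ergodicAvg S n x) - J (ergodicAvg S n y))
        + (J (ergodicAvg S n y) - J (ergodicAvg S m y))
        - (J (ergodicAvg S m x) - J (ergodicAvg S m y)) := by abel
  rw [e]
  refine (norm_sub_le _ _).trans_lt ?_
  linarith [norm_add_le (J (ergodicAvg S n x) - J (ergodicAvg S n y))
    (J (ergodicAvg S n y) - J (ergodicAvg S m y))]

end MeanErgodic

/-! ### Transfer to L¹ ∩ L². -/

section L2

variable {Ω : Type*} [MeasurableSpace Ω] {μ : Measure Ω}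

/-- The subspace `L¹ ∩ L²` of `L¹`. -/
def interL2 (μ : Measure Ω) : Submodule ℂ (Lp ℂ 1 μ) where
  carrier := {f | MemLp f 2 μ}
  add_mem' {f g} hf hg := (memLp_congr_ae (Lp.coeFn_add f g)).2 (hf.add hg)
  zero_mem' := (memLp_congr_ae (Lp.coeFn_zero ℂ 1 μ)).2 MemLp.zero
  smul_mem' c f hf := (memLp_congr_ae (Lp.coeFn_smul c f)).2 (hf.const_smul c)

theorem interL2.memLp (f : interL2 μ) : MemLp (f : Lp ℂ 1 μ) 2 μ := f.2

/-- The inclusion of `L¹ ∩ L²` in `L²`. -/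
noncomputable def interL2.toL2 : interL2 μ →ₗ[ℂ] Lp ℂ 2 μ where
  toFun f := MemLp.toLp f.1 (interL2.memLp f)
  map_add' f g :=
    (MemLp.toLp_congr _ ((interL2.memLp f).add (interL2.memLp g)) (Lp.coeFn_add _ _)).trans
      (MemLp.toLp_add (interL2.memLp f) (interL2.memLp g))
  map_smul' c f :=
    (MemLp.toLp_congr _ ((interL2.memLp f).const_smul c) (Lp.coeFn_smul _ _)).trans
      (MemLp.toLp_const_smul c (interL2.memLp f))

theorem eLpNorm_two_sq (f : Ω → ℂ) : eLpNorm f 2 μ ^ 2 = ∫⁻ x, ‖f x‖ₑ ^ 2 ∂μ := by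
  rw [eLpNorm_eq_lintegral_rpow_enorm_toReal (by simp) (by simp), ← ENNReal.rpow_natCast,
    ← ENNReal.rpow_mul]
  simp

theorem IsDunfordSchwartz.eLpNorm_two_le {T : Lp ℂ 1 μ →ₗ[ℂ] Lp ℂ 1 μ}
    (hT : IsDunfordSchwartz T) (f : Lp ℂ 1 μ) : eLpNorm (T f) 2 μ ≤ eLpNorm f 2 μ := by
  rw [← ENNReal.pow_le_pow_left_iff two_ne_zero, eLpNorm_two_sq, eLpNorm_two_sq]
  exact hT.lintegral_sq_le f

theorem IsDunfordSchwartz.map_mem_interL2 {T : Lp ℂ 1 μ →ₗ[ℂ] Lp ℂ 1 μ}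
    (hT : IsDunfordSchwartz T) (f : Lp ℂ 1 μ) (hf : f ∈ interL2 μ) : T f ∈ interL2 μ :=
  ⟨Lp.aestronglyMeasurable _, (hT.eLpNorm_two_le f).trans_lt hf.2⟩

theorem restrict_pow_apply {V : Type*} [AddCommGroup V] [Module ℂ V] (p : Submodule ℂ V)
    (T : V →ₗ[ℂ] V) (hp : ∀ v ∈ p, T v ∈ p) (k : ℕ) (v : p) :
    (((T.restrict hp) ^ k) v : V) = (T ^ k) v := by
  induction k with
  | zero => simp
  | succ k ih => simp only [pow_succ', Module.End.mul_apply, LinearMap.coe_restrict_apply, ih]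

theorem IsDunfordSchwartz.cauchy_ergodicAvg {T : Lp ℂ 1 μ →ₗ[ℂ] Lp ℂ 1 μ}
    (hT : IsDunfordSchwartz T) {f : Lp ℂ 1 μ} (hf : MemLp f 2 μ) {ε : ℝ≥0∞} (hε : 0 < ε) :
    ∃ N, ∀ m ≥ N, ∀ n ≥ N,
      ∫⁻ x, ‖(ergodicAvg T m f - ergodicAvg T n f) x‖ₑ ^ 2 ∂μ ≤ ε := by
  have hJ : ∀ v : interL2 μ, ‖interL2.toL2 v‖ = (eLpNorm v.1 2 μ).toReal := fun v =>
    Lp.norm_toLp _ (interL2.memLp v)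
  set S := T.restrict hT.map_mem_interL2
  have hS : ∀ v : interL2 μ, ‖interL2.toL2 (S v)‖ ≤ ‖interL2.toL2 v‖ := by
    intro v
    rw [hJ, hJ]
    exact ENNReal.toReal_mono v.2.2.ne (hT.eLpNorm_two_le v.1)
  have hav : ∀ n, ((ergodicAvg S n ⟨f, hf⟩ : interL2 μ) : Lp ℂ 1 μ) = ergodicAvg T n f := by
    intro n
    rw [ergodicAvg_apply, ergodicAvg_apply, Submodule.coe_smul, Submodule.coe_sum]
    simp_rw [S, restrict_pow_apply]
  have h := Metric.cauchySeq_iff.1 (cauchySeq_map_ergodicAvg hS (⟨f, hf⟩ : interL2 μ))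
  -- Choosing δ below both 1 and ε gives δ² ≤ ε, including when ε is infinite.
  obtain ⟨δ, hδ, hδε⟩ : ∃ δ : NNReal, 0 < δ ∧ (δ : ℝ≥0∞) ^ 2 ≤ ε := by
    obtain ⟨δ, h1, h2⟩ := ENNReal.exists_nnreal_pos_mul_lt
      (a := 1) ENNReal.one_ne_top (b := min 1 ε) (by simp [hε.ne'])
    refine ⟨δ, h1, ?_⟩
    have h3 : (δ : ℝ≥0∞) ≤ 1 := by simpa using h2.le.trans (min_le_left _ _)
    have h4 : (δ : ℝ≥0∞) ≤ ε := by simpa using h2.le.trans (min_le_right _ _)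
    calc (δ : ℝ≥0∞) ^ 2 = δ * δ := sq _
      _ ≤ 1 * ε := mul_le_mul' h3 h4
      _ = ε := one_mul _
  obtain ⟨N, hN⟩ := h δ hδ
  refine ⟨N, fun m hm n hn => ?_⟩
  have h1 := hN m hm n hn
  rw [dist_eq_norm, ← map_sub, hJ, Submodule.coe_sub, hav, hav] at h1
  rw [← eLpNorm_two_sq]
  refine le_trans ?_ hδε
  gcongr
  have h2 : MemLp (ergodicAvg T m f - ergodicAvg T n f) 2 μ := by
    rw [← hav, ← hav, ← Submodule.coe_sub]
    exact interL2.memLp _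
  rw [← ENNReal.toReal_le_toReal h2.2.ne ENNReal.coe_ne_top]
  exact h1.le

end L2

/-! ### Almost uniform Cauchy sequences and their limits. -/

section AlmostUniform

variable {Ω : Type*} [MeasurableSpace Ω] {μ : Measure Ω}

/-- A sequence of functions is almost uniformly Cauchy if, up to sets of small (outer) measure, its
tails oscillate little. -/
def AlmostUniformCauchy (μ : Measure Ω) (u : ℕ → Ω → ℂ) : Prop :=
  ∀ ε : ℝ, 0 < ε → ∀ δ : ℝ≥0∞, 0 < δ →
    ∃ (N : ℕ) (v : Ω → ℂ), μ {x | ∃ n ≥ N, ε < ‖u n x - v x‖} ≤ δ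

namespace AlmostUniformCauchy

/-- The closedness half of the Banach principle; the approximant may depend on both tolerances. -/
theorem of_approx {u : ℕ → Ω → ℂ}
    (h : ∀ ε : ℝ, 0 < ε → ∀ δ : ℝ≥0∞, 0 < δ → ∃ w, AlmostUniformCauchy μ w ∧
      ∃ N, μ {x | ∃ n ≥ N, ε < ‖u n x - w n x‖} ≤ δ) : AlmostUniformCauchy μ u := by
  intro ε hε δ hδ
  obtain ⟨w, hw, N, hN⟩ := h (ε / 2) (by positivity) (δ / 2) (ENNReal.half_pos hδ.ne')
  obtain ⟨M, v, hM⟩ := hw (ε / 2) (by positivity) (δ / 2) (ENNReal.half_pos hδ.ne')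
  refine ⟨max N M, v, ?_⟩
  refine (measure_mono ?_).trans ((measure_union_le _ _).trans
    ((add_le_add hN hM).trans (ENNReal.add_halves δ).le))
  rintro x ⟨n, hn, hx⟩
  by_contra hcon
  simp only [Set.mem_union, Set.mem_ofPred_eq, not_or, not_exists, not_and, not_lt] at hcon
  have h1 := hcon.1 n (le_of_max_le_left hn)
  have h2 := hcon.2 n (le_of_max_le_right hn)
  linarith [norm_sub_le_norm_sub_add_norm_sub (u n x) (w n x) (v x)]

theorem congr {u w : ℕ → Ω → ℂ} (hw : AlmostUniformCauchy μ w) (h : ∀ n, u n =ᵐ[μ] w n) :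
    AlmostUniformCauchy μ u := by
  refine of_approx fun ε hε δ hδ => ⟨w, hw, 0, ?_⟩
  refine le_trans (le_of_eq ?_) hδ.le
  refine measure_mono_null ?_ (ae_iff.1 (ae_all_iff.2 h))
  rintro x ⟨n, -, hx⟩ hcon
  rw [hcon n, sub_self, norm_zero] at hx
  linarith

theorem zero : AlmostUniformCauchy μ (fun _ _ => (0 : ℂ)) := by
  intro ε hε δ hδ
  refine ⟨0, 0, ?_⟩
  simp [hε.not_gt]

theorem add {u w : ℕ → Ω → ℂ} (hu : AlmostUniformCauchy μ u) (hw : AlmostUniformCauchy μ w) :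
    AlmostUniformCauchy μ (fun n x => u n x + w n x) := by
  intro ε hε δ hδ
  obtain ⟨N, a, hN⟩ := hu (ε / 2) (by positivity) (δ / 2) (ENNReal.half_pos hδ.ne')
  obtain ⟨M, b, hM⟩ := hw (ε / 2) (by positivity) (δ / 2) (ENNReal.half_pos hδ.ne')
  refine ⟨max N M, fun x => a x + b x, ?_⟩
  refine (measure_mono ?_).trans ((measure_union_le _ _).trans
    ((add_le_add hN hM).trans (ENNReal.add_halves δ).le))
  rintro x ⟨n, hn, hx⟩
  by_contra hcon
  simp only [Set.mem_union, Set.mem_ofPred_eq, not_or, not_exists, not_and, not_lt] at hcon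
  have h1 := hcon.1 n (le_of_max_le_left hn)
  have h2 := hcon.2 n (le_of_max_le_right hn)
  have e : u n x + w n x - (a x + b x) = (u n x - a x) + (w n x - b x) := by ring
  rw [e] at hx
  linarith [norm_add_le (u n x - a x) (w n x - b x)]

theorem const_mul {u : ℕ → Ω → ℂ} (hu : AlmostUniformCauchy μ u) (c : ℂ) :
    AlmostUniformCauchy μ (fun n x => c * u n x) := by
  intro ε hε δ hδ
  obtain ⟨N, a, hN⟩ := hu (ε / (‖c‖ + 1)) (by positivity) δ hδ
  refine ⟨N, fun x => c * a x, (measure_mono ?_).trans hN⟩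
  rintro x ⟨n, hn, hx⟩
  refine ⟨n, hn, ?_⟩
  rw [← mul_sub, norm_mul] at hx
  rw [div_lt_iff₀ (by positivity)]
  nlinarith [norm_nonneg (u n x - a x)]

theorem sum {ι : Type*} (s : Finset ι) {u : ι → ℕ → Ω → ℂ}
    (hu : ∀ i ∈ s, AlmostUniformCauchy μ (u i)) :
    AlmostUniformCauchy μ (fun n x => ∑ i ∈ s, u i n x) := by
  classical
  induction s using Finset.induction_on with
  | empty => simpa using zero
  | insert a s ha ih =>
    simp only [Finset.sum_insert ha]
    exact (hu a (Finset.mem_insert_self a s)).add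
      (ih fun i hi => hu i (Finset.mem_insert_of_mem hi))

theorem ae_cauchySeq {u : ℕ → Ω → ℂ} (hu : AlmostUniformCauchy μ u) :
    ∀ᵐ x ∂μ, CauchySeq fun n => u n x := by
  have h : ∀ k : ℕ, ∀ᵐ x ∂μ, ∃ (N : ℕ) (z : ℂ), ∀ n ≥ N, ‖u n x - z‖ ≤ 1 / ((k : ℝ) + 1) := by
    intro k
    rw [ae_iff]
    refine nonpos_iff_eq_zero.1 (le_of_forall_gt fun δ hδ => ?_)
    obtain ⟨δ', h1, h2⟩ := exists_between hδ
    obtain ⟨N, v, hv⟩ := hu (1 / ((k : ℝ) + 1)) (by positivity) δ' h1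
    refine lt_of_le_of_lt ((measure_mono ?_).trans hv) h2
    intro x hx
    simp only [Set.mem_ofPred_eq, not_exists, not_forall, not_le] at hx ⊢
    obtain ⟨n, hn, h⟩ := hx N (v x)
    exact ⟨n, hn, h⟩
  filter_upwards [ae_all_iff.2 h] with x hx
  rw [Metric.cauchySeq_iff]
  intro ε hε
  obtain ⟨k, hk⟩ := exists_nat_one_div_lt (show 0 < ε / 2 by positivity)
  obtain ⟨N, z, hN⟩ := hx k
  refine ⟨N, fun m hm n hn => ?_⟩
  rw [dist_eq_norm]
  have h1 := hN m hm
  have h2 := hN n hn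
  rw [norm_sub_rev] at h2
  linarith [norm_sub_le_norm_sub_add_norm_sub (u m x) z (u n x)]

theorem exists_tendstoAU {F : ℕ → Ω →ₘ[μ] ℂ} (hF : AlmostUniformCauchy μ fun n => F n) :
    ∃ g : Ω →ₘ[μ] ℂ, TendstoAU F g := by
  obtain ⟨g, hg, hlim⟩ := exists_stronglyMeasurable_limit_of_tendsto_ae
    (fun n => (F n).aestronglyMeasurable)
    (hF.ae_cauchySeq.mono fun x hx => cauchySeq_tendsto_of_complete hx)
  refine ⟨AEEqFun.mk g hg.aestronglyMeasurable, fun ε hε => ?_⟩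
  obtain ⟨δ, hδ0, hδ⟩ := ENNReal.exists_pos_sum_of_countable'
    (ENNReal.ofReal_pos.2 hε).ne' ℕ
  choose N v hNv using fun k : ℕ => hF (1 / ((k : ℝ) + 1)) (by positivity) (δ k) (hδ0 k)
  -- The centres `v k` need not be measurable, so neither need B; its measurable hull is removed
  -- instead.
  set B : Set Ω := ⋃ k, {x | ∃ n ≥ N k, 1 / ((k : ℝ) + 1) < ‖F n x - v k x‖}
  have hB : μ B ≤ ENNReal.ofReal ε :=
    (measure_iUnion_le _).trans ((ENNReal.tsum_le_tsum hNv).trans hδ.le)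
  refine ⟨(toMeasurable μ B)ᶜ, (measurableSet_toMeasurable μ B).compl, ?_, ?_⟩
  · rwa [compl_compl, measure_toMeasurable]
  rw [ENNReal.tendsto_nhds_zero]
  intro η hη
  obtain ⟨k, hk⟩ : ∃ k : ℕ, ENNReal.ofReal (2 * (1 / ((k : ℝ) + 1))) < η := by
    have h1 : Tendsto (fun k : ℕ => ENNReal.ofReal (2 * (1 / ((k : ℝ) + 1)))) atTop (𝓝 0) := by
      have := ENNReal.tendsto_ofReal (tendsto_one_div_add_atTop_nhds_zero_nat.const_mul (2 : ℝ))
      simpa using this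
    exact (h1.eventually_lt_const hη).exists
  filter_upwards [eventually_ge_atTop (N k)] with n hn
  refine le_trans ?_ hk.le
  rw [eLpNorm_exponent_top]
  refine eLpNormEssSup_le_of_ae_bound ?_
  filter_upwards [hlim, AEEqFun.coeFn_mk g hg.aestronglyMeasurable] with x hx hgx
  by_cases hxG : x ∈ (toMeasurable μ B)ᶜ
  · rw [Set.indicator_of_mem hxG, hgx]
    have hxB : x ∉ B := fun h => hxG (subset_toMeasurable μ B h)
    have hbd : ∀ m ≥ N k, ‖F m x - v k x‖ ≤ 1 / ((k : ℝ) + 1) := by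
      intro m hm
      by_contra hcon
      exact hxB (Set.mem_iUnion.2 ⟨k, m, hm, not_le.1 hcon⟩)
    -- Two tail values off B differ by at most 2/(k+1), and letting m tend to infinity replaces one
    -- of them by the limit.
    refine le_of_tendsto (hx.sub_const (F n x)).norm ?_
    filter_upwards [eventually_ge_atTop (N k)] with m hm
    have h1 := hbd m hm
    have h2 := hbd n hn
    rw [norm_sub_rev] at h2
    linarith [norm_sub_le_norm_sub_add_norm_sub (F m x) (v k x) (F n x)]
  · rw [Set.indicator_of_notMem hxG, norm_zero]
    positivity

end AlmostUniformCauchy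

end AlmostUniform

/-! ### Almost uniform convergence of unweighted averages on bounded functions. -/

section Averages

variable {Ω : Type*} [MeasurableSpace Ω] {μ : Measure Ω}

theorem ergodicAvg_comm {V : Type*} [AddCommGroup V] [Module ℂ V] (T : V →ₗ[ℂ] V) (m n : ℕ)
    (v : V) : ergodicAvg T m (ergodicAvg T n v) = ergodicAvg T n (ergodicAvg T m v) := by
  have h : Commute (ergodicAvg T m) (ergodicAvg T n) :=
    ((Commute.sum_left _ _ _ fun i _ => Commute.sum_right _ _ _ fun j _ =>
      Commute.pow_pow_self T i j).smul_left _).smul_right _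
  exact LinearMap.congr_fun h.eq v

/-- `v - A_n v` is a coboundary. -/
theorem sub_ergodicAvg {V : Type*} [AddCommGroup V] [Module ℂ V] (T : V →ₗ[ℂ] V) {n : ℕ}
    (hn : 0 < n) (v : V) :
    let w := (n : ℂ)⁻¹ • ∑ k ∈ Finset.range n, ∑ j ∈ Finset.range k, (T ^ j) v
    v - ergodicAvg T n v = w - T w := by
  intro w
  have hn' : (n : ℂ) ≠ 0 := by exact_mod_cast hn.ne'
  have h1 : w - T w = (n : ℂ)⁻¹ • ∑ k ∈ Finset.range n, (v - (T ^ k) v) := by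
    simp only [w, map_smul, map_sum, ← smul_sub, ← Finset.sum_sub_distrib]
    congr 1
    refine Finset.sum_congr rfl fun k _ => ?_
    rw [← sum_pow_sub_pow_succ]
    refine Finset.sum_congr rfl fun j _ => ?_
    rw [map_sub, ← Module.End.mul_apply, ← Module.End.mul_apply, ← pow_succ, ← pow_succ']
  rw [h1, Finset.sum_sub_distrib, smul_sub, Finset.sum_const, Finset.card_range,
    ← Nat.cast_smul_eq_nsmul ℂ, inv_smul_smul₀ hn', ergodicAvg_apply]

theorem coeFn_ergodicAvg (T : Lp ℂ 1 μ →ₗ[ℂ] Lp ℂ 1 μ) (f : Lp ℂ 1 μ) :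
    ∀ᵐ x ∂μ, ∀ n, ergodicAvg T n f x = (n : ℂ)⁻¹ * weightedSum T (fun _ => 1) n f x := by
  refine ae_all_iff.2 fun n => ?_
  have e : ergodicAvg T n f = (n : ℂ)⁻¹ • weightedSum T (fun _ => 1) n f := by
    simp [ergodicAvg_apply, weightedSum]
  rw [e]
  exact Lp.coeFn_smul _ _

/-- Write f - A_n f = w - Tw with |w| ≤ nM; the j-th average telescopes to (w - T^j w)/j. -/
theorem IsDunfordSchwartz.ergodicAvg_coboundary_le {T : Lp ℂ 1 μ →ₗ[ℂ] Lp ℂ 1 μ}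
    (hT : IsDunfordSchwartz T) {f : Lp ℂ 1 μ} {M : NNReal} (hf : ∀ᵐ x ∂μ, ‖f x‖ₑ ≤ M)
    {n : ℕ} (hn : 0 < n) :
    ∀ᵐ x ∂μ, ∀ j : ℕ, ‖ergodicAvg T j (f - ergodicAvg T n f) x‖ ≤ 2 * n * M / j := by
  set w := (n : ℂ)⁻¹ • ∑ k ∈ Finset.range n, ∑ j ∈ Finset.range k, (T ^ j) f with hw
  have e : f - ergodicAvg T n f = w - T w := sub_ergodicAvg T hn f
  have hwb : ∀ᵐ x ∂μ, ‖w x‖ₑ ≤ (n * M : NNReal) := by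
    have e' : w = (n : ℂ)⁻¹ • ∑ k ∈ Finset.range n, weightedSum T (fun _ => 1) k f := by
      simp [hw, weightedSum]
    rw [e']
    filter_upwards [Lp.coeFn_smul (n : ℂ)⁻¹ (∑ k ∈ Finset.range n, weightedSum T (fun _ => 1) k f),
      Lp.coeFn_finset_sum (Finset.range n) (fun k => weightedSum T (fun _ => 1) k f),
      hT.weightedSum_ae_le (fun _ => 1) hf] with x h1 h2 h3
    rw [h1, Pi.smul_apply, h2, enorm_le_coe, ← NNReal.coe_le_coe, coe_nnnorm, norm_smul, norm_inv,
      Complex.norm_natCast, inv_mul_le_iff₀ (by positivity)]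
    refine (norm_sum_le_of_le _ fun k hk => (h3 k).trans
      (show _ ≤ (n : ℝ) * M from ?_)).trans ?_
    · simp only [norm_one, Finset.sum_const, Finset.card_range, nsmul_eq_mul, mul_one]
      gcongr
      exact (Finset.mem_range.1 hk).le
    · simp
  rw [e]
  refine ae_all_iff.2 fun j => ?_
  rw [ergodicAvg_sub_map]
  filter_upwards [Lp.coeFn_smul (j : ℂ)⁻¹ (w - (T ^ j) w), Lp.coeFn_sub w ((T ^ j) w), hwb,
    hT.pow_ae_le hwb j] with x h1 h2 h3 h4
  rw [h1, Pi.smul_apply, h2, Pi.sub_apply, norm_smul, norm_inv, Complex.norm_natCast,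
    div_eq_inv_mul]
  gcongr
  rw [enorm_le_coe, ← NNReal.coe_le_coe, coe_nnnorm] at h3 h4
  push_cast at h3 h4
  linarith [norm_sub_le (w x) ((T ^ j) w x)]

theorem Lp.memLp_two_of_ae_le {f : Lp ℂ 1 μ} {M : NNReal} (hf : ∀ᵐ x ∂μ, ‖f x‖ₑ ≤ M) :
    MemLp f 2 μ := by
  refine ⟨Lp.aestronglyMeasurable f, ?_⟩
  have h : eLpNorm f 2 μ ^ 2 < ∞ := by
    rw [eLpNorm_two_sq]
    calc ∫⁻ x, ‖f x‖ₑ ^ 2 ∂μ ≤ ∫⁻ x, M * ‖f x‖ₑ ∂μ := by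
          refine lintegral_mono_ae ?_
          filter_upwards [hf] with x hx
          rw [sq]
          gcongr
      _ = M * ‖f‖ₑ := by
          rw [lintegral_const_mul' _ _ ENNReal.coe_ne_top, Lp.enorm_eq_lintegral]
      _ < ∞ := ENNReal.mul_lt_top ENNReal.coe_lt_top enorm_lt_top
  simpa using h

/-- A_i f is almost invariant: compare it with A_j f for much larger j. The difference D is small in
L², so the maximal inequality controls its averages, while A_n A_j f - A_j f is uniformly small by
telescoping. -/
theorem IsDunfordSchwartz.measure_ergodicAvg_oscillation_le {T : Lp ℂ 1 μ →ₗ[ℂ] Lp ℂ 1 μ}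
    (hT : IsDunfordSchwartz T) {f : Lp ℂ 1 μ} {M : NNReal} (hf : ∀ᵐ x ∂μ, ‖f x‖ₑ ≤ M)
    {l : NNReal} (hl : 0 < l) {δ : ℝ≥0∞} {i : ℕ}
    (hi : ∀ j ≥ i, ∫⁻ x, ‖(ergodicAvg T i f - ergodicAvg T j f) x‖ₑ ^ 2 ∂μ ≤ l ^ 2 * δ) :
    μ {x | ∃ n > 0, 5 * (l : ℝ)
      < ‖ergodicAvg T n (ergodicAvg T i f) x - ergodicAvg T i f x‖} ≤ δ := by
  set E : ℕ → Set Ω := fun N => {x | ∃ n ≤ N, 0 < n ∧ 5 * (l : ℝ)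
      < ‖ergodicAvg T n (ergodicAvg T i f) x - ergodicAvg T i f x‖} with hE
  have hU : {x | ∃ n > 0, 5 * (l : ℝ)
      < ‖ergodicAvg T n (ergodicAvg T i f) x - ergodicAvg T i f x‖} = ⋃ N, E N := by
    ext x
    simp only [hE, Set.mem_ofPred_eq, Set.mem_iUnion]
    exact ⟨fun ⟨n, h0, h⟩ => ⟨n, n, le_rfl, h0, h⟩, fun ⟨_, n, _, h0, h⟩ => ⟨n, h0, h⟩⟩
  have hmono : Monotone E := fun N N' h x ⟨n, hn, hx⟩ => ⟨n, hn.trans h, hx⟩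
  rw [hU, hmono.measure_iUnion]
  refine iSup_le fun N => ?_
  -- Here j depends on N, but the resulting measure bound δ does not, so N may tend to infinity.
  obtain ⟨j, hij, hj⟩ : ∃ j ≥ i, 2 * N * (M : ℝ) / j ≤ l := by
    have h1 := (tendsto_const_div_atTop_nhds_zero_nat (2 * N * (M : ℝ))).eventually_le_const
      (show (0 : ℝ) < l from hl)
    obtain ⟨j, h2, h3⟩ := (h1.and (eventually_ge_atTop i)).exists
    exact ⟨j, h3, h2⟩
  set D := ergodicAvg T i f - ergodicAvg T j f with hD
  have hmax := (hT.maximal_sq (β := fun _ => 1) (by simp) D l).trans (hi j hij)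
  rw [ENNReal.mul_le_mul_iff_right (by simp [hl.ne']) (by simp)] at hmax
  refine (measure_mono_ae ?_).trans hmax
  have hcob : ∀ᵐ x ∂μ, ∀ n > 0,
      ‖ergodicAvg T j (f - ergodicAvg T n f) x‖ ≤ 2 * n * M / j :=
    ae_all_iff.2 fun n => by
      by_cases hn : 0 < n
      · filter_upwards [hT.ergodicAvg_coboundary_le hf hn] with x hx _ using hx j
      · exact Eventually.of_forall fun x h => absurd h hn
  have hsub1 : ∀ᵐ x ∂μ, ∀ n, ergodicAvg T j (f - ergodicAvg T n f) x
      = ergodicAvg T j f x - ergodicAvg T n (ergodicAvg T j f) x :=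
    ae_all_iff.2 fun n => by
      rw [map_sub, ergodicAvg_comm]
      exact Lp.coeFn_sub _ _
  have hsub2 : ∀ᵐ x ∂μ, ∀ n, ergodicAvg T n D x
      = ergodicAvg T n (ergodicAvg T i f) x - ergodicAvg T n (ergodicAvg T j f) x :=
    ae_all_iff.2 fun n => by
      rw [hD, map_sub]
      exact Lp.coeFn_sub _ _
  -- D is its own average of length 1, so one exceptional set controls both D and A_n D.
  have hone : ergodicAvg T 1 D = D := by simp [ergodicAvg_apply]
  filter_upwards [hcob, hsub1, hsub2, coeFn_ergodicAvg T D, Lp.coeFn_sub (ergodicAvg T i f)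
    (ergodicAvg T j f)] with x h1 h2 h3 h4 h5
  rintro ⟨n, hnN, hn, hx⟩
  by_contra hcon
  have hcon' : ∀ k : ℕ, 0 < k → ‖ergodicAvg T k D x‖ ≤ 2 * l := by
    intro k hk
    rw [h4, norm_mul, norm_inv, Complex.norm_natCast, inv_mul_le_iff₀ (by positivity)]
    by_contra hc
    exact hcon ⟨k, not_le.1 hc⟩
  have a1 := hcon' n hn
  have a2 := hcon' 1 one_pos
  have a3 : ‖ergodicAvg T j f x - ergodicAvg T n (ergodicAvg T j f) x‖ ≤ l := by
    rw [← h2]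
    refine (h1 n hn).trans (le_trans ?_ hj)
    gcongr
  rw [h3] at a1
  rw [hone, hD, h5, Pi.sub_apply] at a2
  -- The three terms are A_n D, A_j(f - A_n f) and D, bounded by 2l, l and 2l: hence the constant 5.
  have e : ergodicAvg T n (ergodicAvg T i f) x - ergodicAvg T i f x
      = (ergodicAvg T n (ergodicAvg T i f) x - ergodicAvg T n (ergodicAvg T j f) x)
        - (ergodicAvg T j f x - ergodicAvg T n (ergodicAvg T j f) x)
        - (ergodicAvg T i f x - ergodicAvg T j f x) := by ring
  rw [e] at hx
  have b1 := norm_sub_le ((ergodicAvg T n (ergodicAvg T i f) x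
    - ergodicAvg T n (ergodicAvg T j f) x)
    - (ergodicAvg T j f x - ergodicAvg T n (ergodicAvg T j f) x))
    (ergodicAvg T i f x - ergodicAvg T j f x)
  have b2 := norm_sub_le (ergodicAvg T n (ergodicAvg T i f) x
    - ergodicAvg T n (ergodicAvg T j f) x)
    (ergodicAvg T j f x - ergodicAvg T n (ergodicAvg T j f) x)
  linarith

theorem IsDunfordSchwartz.almostUniformCauchy_ergodicAvg {T : Lp ℂ 1 μ →ₗ[ℂ] Lp ℂ 1 μ}
    (hT : IsDunfordSchwartz T) {f : Lp ℂ 1 μ} {M : NNReal} (hf : ∀ᵐ x ∂μ, ‖f x‖ₑ ≤ M) :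
    AlmostUniformCauchy μ fun n => ergodicAvg T n f := by
  intro ε hε δ hδ
  -- Of the 6l, 5l covers the oscillation of A_i f and l the passage from A_n f to A_n A_i f.
  obtain ⟨l, hl, hlε⟩ : ∃ l : NNReal, 0 < l ∧ 6 * (l : ℝ) = ε :=
    ⟨(ε / 6).toNNReal, Real.toNNReal_pos.2 (by positivity),
      by rw [Real.coe_toNNReal _ (by positivity)]; ring⟩
  obtain ⟨i₀, hi₀⟩ := hT.cauchy_ergodicAvg (Lp.memLp_two_of_ae_le hf)
    (ε := (l : ℝ≥0∞) ^ 2 * δ) (ENNReal.mul_pos (by simp [hl.ne']) hδ.ne')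
  set i := i₀ + 1
  have h1 := hT.measure_ergodicAvg_oscillation_le hf hl (δ := δ) (i := i)
    fun j hj => hi₀ i (Nat.le_succ _) j ((Nat.le_succ _).trans hj)
  have hlim := (tendsto_const_div_atTop_nhds_zero_nat (2 * i * (M : ℝ))).eventually_le_const
      (show (0 : ℝ) < l from hl)
  obtain ⟨N, hN⟩ := eventually_atTop.1 (hlim.and (eventually_gt_atTop 0))
  refine ⟨N, ergodicAvg T i f, (measure_mono_ae ?_).trans h1⟩
  have hsub : ∀ᵐ x ∂μ, ∀ n, ergodicAvg T n (f - ergodicAvg T i f) x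
      = ergodicAvg T n f x - ergodicAvg T n (ergodicAvg T i f) x :=
    ae_all_iff.2 fun n => by
      rw [map_sub]
      exact Lp.coeFn_sub _ _
  filter_upwards [hsub, hT.ergodicAvg_coboundary_le hf (Nat.succ_pos i₀)] with x h2 h3
  rintro ⟨n, hn, hx⟩
  refine ⟨n, (hN n hn).2, ?_⟩
  have h4 := (h3 n).trans (hN n hn).1
  rw [h2] at h4
  linarith [norm_sub_le_norm_sub_add_norm_sub (ergodicAvg T n f x)
    (ergodicAvg T n (ergodicAvg T i f) x) (ergodicAvg T i f x)]

end Averages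

/-! ### From trigonometric weights to Besicovitch weights, and from bounded f to L¹. -/

section Besicovitch

variable {Ω : Type*} [MeasurableSpace Ω] {μ : Measure Ω}

theorem weightedAverage_eq (T : Lp ℂ 1 μ →ₗ[ℂ] Lp ℂ 1 μ) (β : ℕ → ℂ) (n : ℕ) (f : Lp ℂ 1 μ) :
    weightedAverage T β n f = (n : ℂ)⁻¹ • weightedSum T β n f := by
  rw [weightedAverage, weightedSum, one_div]

theorem coeFn_weightedAverage (T : Lp ℂ 1 μ →ₗ[ℂ] Lp ℂ 1 μ) (β : ℕ → ℂ) (f : Lp ℂ 1 μ) :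
    ∀ᵐ x ∂μ, ∀ n, weightedAverage T β n f x = (n : ℂ)⁻¹ * weightedSum T β n f x := by
  refine ae_all_iff.2 fun n => ?_
  rw [weightedAverage_eq]
  exact Lp.coeFn_smul _ _

theorem IsTrigPolynomial.exists_norm_le {P : ℤ → ℂ} (hP : IsTrigPolynomial P) :
    ∃ C : ℝ, ∀ k, ‖P k‖ ≤ C := by
  obtain ⟨s, z, l, h⟩ := hP
  refine ⟨∑ j, ‖z j‖, fun k => ?_⟩
  rw [h]
  refine norm_sum_le_of_le _ fun j _ => ?_
  rw [norm_mul, norm_zpow, Circle.norm_coe, one_zpow, mul_one]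

theorem weightedAverage_trigPolynomial (T : Lp ℂ 1 μ →ₗ[ℂ] Lp ℂ 1 μ) {s : ℕ} (z : Fin s → ℂ)
    (l : Fin s → Circle) (n : ℕ) (f : Lp ℂ 1 μ) :
    weightedAverage T (fun k => ∑ j, z j * (l j : ℂ) ^ (k : ℤ)) n f
      = ∑ j, z j • ergodicAvg ((l j : ℂ) • T) n f := by
  simp only [weightedAverage, ergodicAvg_apply, Finset.sum_smul, Finset.smul_sum, one_div,
    smul_pow, LinearMap.smul_apply, zpow_natCast]
  rw [Finset.sum_comm]
  refine Finset.sum_congr rfl fun j _ => Finset.sum_congr rfl fun k _ => ?_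
  simp only [smul_smul]
  congr 1
  ring

theorem IsDunfordSchwartz.almostUniformCauchy_trigPolynomial {T : Lp ℂ 1 μ →ₗ[ℂ] Lp ℂ 1 μ}
    (hT : IsDunfordSchwartz T) {P : ℤ → ℂ} (hP : IsTrigPolynomial P) {f : Lp ℂ 1 μ} {M : NNReal}
    (hf : ∀ᵐ x ∂μ, ‖f x‖ₑ ≤ M) :
    AlmostUniformCauchy μ fun n => weightedAverage T (fun k => P k) n f := by
  obtain ⟨s, z, l, h⟩ := hP
  have h1 : AlmostUniformCauchy μ
      (fun n x => ∑ j, z j * ergodicAvg ((l j : ℂ) • T) n f x) :=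
    AlmostUniformCauchy.sum _ fun j _ =>
      ((hT.smul (Circle.norm_coe (l j))).almostUniformCauchy_ergodicAvg hf).const_mul (z j)
  refine h1.congr fun n => ?_
  simp_rw [h, weightedAverage_trigPolynomial]
  have h2 : ∀ᵐ x ∂μ, ∀ j, (z j • ergodicAvg ((l j : ℂ) • T) n f) x
      = z j * ergodicAvg ((l j : ℂ) • T) n f x :=
    ae_all_iff.2 fun j => Lp.coeFn_smul _ _
  filter_upwards [Lp.coeFn_finset_sum Finset.univ
    (fun j => z j • ergodicAvg ((l j : ℂ) • T) n f), h2] with x hx hx2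
  rw [hx]
  exact Finset.sum_congr rfl fun j _ => hx2 j

theorem IsBoundedBesicovitch.exists_eventually_lt {β : ℕ → ℂ} (hβ : IsBoundedBesicovitch β)
    {ε : ℝ} (hε : 0 < ε) : ∃ P : ℤ → ℂ, IsTrigPolynomial P ∧
      ∀ᶠ n : ℕ in atTop, (n : ℝ)⁻¹ * ∑ k ∈ Finset.range n, ‖β k - P (k : ℤ)‖ < ε := by
  obtain ⟨P, hP, hlim⟩ := hβ.approx ε hε
  refine ⟨P, hP, ?_⟩
  obtain ⟨C, hC0, hC⟩ := hβ.bounded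
  obtain ⟨D, hD⟩ := hP.exists_norm_le
  simp_rw [← one_div]
  refine eventually_lt_of_limsup_lt hlim ?_
  refine isBoundedUnder_of ⟨C + D, fun n => ?_⟩
  have h0 : 0 ≤ C + D := (norm_nonneg (β 0 - P 0)).trans
    ((norm_sub_le _ _).trans (add_le_add (hC 0) (hD 0)))
  rw [one_div]
  refine inv_mul_le_of_le_mul₀ (Nat.cast_nonneg n) h0 ?_
  refine (Finset.sum_le_sum fun k _ => (norm_sub_le _ _).trans
    (add_le_add (hC k) (hD (k : ℤ)))).trans ?_
  rw [Finset.sum_const, Finset.card_range, nsmul_eq_mul]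

theorem weightedSum_sub_weight (T : Lp ℂ 1 μ →ₗ[ℂ] Lp ℂ 1 μ) (β γ : ℕ → ℂ) (k : ℕ)
    (f : Lp ℂ 1 μ) :
    weightedSum T (fun j => β j - γ j) k f = weightedSum T β k f - weightedSum T γ k f := by
  simp [weightedSum, sub_smul]

theorem IsDunfordSchwartz.almostUniformCauchy_of_bounded {T : Lp ℂ 1 μ →ₗ[ℂ] Lp ℂ 1 μ}
    (hT : IsDunfordSchwartz T) {β : ℕ → ℂ} (hβ : IsBoundedBesicovitch β) {f : Lp ℂ 1 μ}
    {M : NNReal} (hf : ∀ᵐ x ∂μ, ‖f x‖ₑ ≤ M) :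
    AlmostUniformCauchy μ fun n => weightedAverage T β n f := by
  refine AlmostUniformCauchy.of_approx fun ε hε δ hδ => ?_
  -- M + 1 rather than M, since M may vanish.
  obtain ⟨P, hP, hlim⟩ := hβ.exists_eventually_lt (show 0 < ε / (M + 1) by positivity)
  obtain ⟨N, hN⟩ := eventually_atTop.1 hlim
  refine ⟨_, hT.almostUniformCauchy_trigPolynomial hP hf, N, le_trans (le_of_eq ?_) hδ.le⟩
  have hsub : ∀ᵐ x ∂μ, ∀ n, weightedSum T (fun k => β k - P k) n f x
      = weightedSum T β n f x - weightedSum T (fun k => P k) n f x :=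
    ae_all_iff.2 fun n => by
      rw [weightedSum_sub_weight]
      exact Lp.coeFn_sub _ _
  have hgood : ∀ᵐ x ∂μ, ¬ ∃ n ≥ N, ε < ‖weightedAverage T β n f x
      - weightedAverage T (fun k => P k) n f x‖ := by
    filter_upwards [hsub, coeFn_weightedAverage T β f, coeFn_weightedAverage T (fun k => P k) f,
      hT.weightedSum_ae_le (fun k => β k - P k) hf] with x h1 h2 h3 h4
    rintro ⟨n, hn, hx⟩
    rw [h2, h3, ← mul_sub, ← h1, norm_mul, norm_inv, Complex.norm_natCast] at hx
    have h5 : (n : ℝ)⁻¹ * ‖weightedSum T (fun k => β k - P k) n f x‖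
        ≤ ε / (M + 1) * M := by
      refine (mul_le_mul_of_nonneg_left (h4 n) (by positivity)).trans ?_
      rw [← mul_assoc]
      gcongr
      exact (hN n hn).le
    have h6 : ε / (M + 1) * M ≤ ε := by
      rw [div_mul_eq_mul_div, div_le_iff₀ (by positivity)]
      nlinarith
    linarith
  simpa using ae_iff.1 hgood

/-- Bounded functions are dense in `L¹`. -/
theorem exists_bounded_approx (f : Lp ℂ 1 μ) {η : ℝ≥0∞} (hη : 0 < η) :
    ∃ (R : Lp ℂ 1 μ) (M : NNReal), (∀ᵐ x ∂μ, ‖R x‖ₑ ≤ M) ∧ ∫⁻ x, ‖(f - R) x‖ₑ ∂μ ≤ η := by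
  choose R hR hG using fun n : ℕ => exists_truncation f n
  have hm : AEMeasurable (fun x => ‖f x‖ₑ) μ := (Lp.aestronglyMeasurable f).enorm
  have h1 : Tendsto (fun n : ℕ => ∫⁻ x, (‖f x‖ₑ - ((n : NNReal) : ℝ≥0∞)) ∂μ) atTop
      (𝓝 (∫⁻ _, 0 ∂μ)) := by
    refine tendsto_lintegral_of_dominated_convergence' (fun x => ‖f x‖ₑ)
      (fun n => hm.sub_const _) (fun n => Eventually.of_forall fun x => tsub_le_self) ?_ ?_
    · rw [← Lp.enorm_eq_lintegral]
      exact enorm_ne_top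
    · refine Eventually.of_forall fun x => ?_
      refine tendsto_const_nhds.congr' ?_
      obtain ⟨N, hN⟩ := exists_nat_ge ‖f x‖₊
      filter_upwards [eventually_ge_atTop N] with n hn
      refine (tsub_eq_zero_of_le ?_).symm
      rw [enorm_le_coe]
      exact hN.trans (by exact_mod_cast hn)
  rw [lintegral_zero] at h1
  obtain ⟨n, hn⟩ := (h1.eventually_lt_const hη).exists
  refine ⟨R n, n, hR n, ?_⟩
  rw [lintegral_congr_ae (hG n)]
  exact hn.le

theorem IsDunfordSchwartz.almostUniformCauchy_weightedAverage {T : Lp ℂ 1 μ →ₗ[ℂ] Lp ℂ 1 μ}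
    (hT : IsDunfordSchwartz T) {β : ℕ → ℂ} (hβ : IsBoundedBesicovitch β) (f : Lp ℂ 1 μ) :
    AlmostUniformCauchy μ fun n => weightedAverage T β n f := by
  refine AlmostUniformCauchy.of_approx fun ε hε δ hδ => ?_
  obtain ⟨C, hC0, hC⟩ := hβ.bounded
  obtain ⟨l, hl, hlε⟩ : ∃ l : NNReal, 0 < l ∧ (l : ℝ) * C = ε :=
    ⟨(ε / C).toNNReal, Real.toNNReal_pos.2 (by positivity),
      by rw [Real.coe_toNNReal _ (by positivity)]; field_simp⟩
  have hl0 : (l : ℝ≥0∞) ≠ 0 := by simp [hl.ne']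
  obtain ⟨R, M, hR, hfR⟩ := exists_bounded_approx f (η := l * δ) (ENNReal.mul_pos hl0 hδ.ne')
  refine ⟨_, hT.almostUniformCauchy_of_bounded hβ hR, 0, ?_⟩
  -- The maximal inequality needs weights of modulus at most 1, so β is divided by C and the level
  -- becomes l = ε/C.
  have hmax := (hT.maximal (β := fun k => (C : ℂ)⁻¹ * β k) (fun k => by
    rw [norm_mul, norm_inv, Complex.norm_real, Real.norm_of_nonneg hC0.le,
      inv_mul_le_iff₀ hC0, mul_one]
    exact hC k) (f - R) l).trans hfR
  rw [ENNReal.mul_le_mul_iff_right hl0 ENNReal.coe_ne_top] at hmax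
  refine (measure_mono_ae ?_).trans hmax
  have hsub : ∀ᵐ x ∂μ, ∀ n, weightedSum T (fun k => (C : ℂ)⁻¹ * β k) n (f - R) x
      = (C : ℂ)⁻¹ * (weightedSum T β n f x - weightedSum T β n R x) :=
    ae_all_iff.2 fun n => by
      have e : weightedSum T (fun k => (C : ℂ)⁻¹ * β k) n (f - R)
          = (C : ℂ)⁻¹ • (weightedSum T β n f - weightedSum T β n R) := by
        rw [← weightedSum_sub]
        simp [weightedSum, Finset.smul_sum, smul_smul]
      rw [e]
      filter_upwards [Lp.coeFn_smul (C : ℂ)⁻¹ (weightedSum T β n f - weightedSum T β n R),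
        Lp.coeFn_sub (weightedSum T β n f) (weightedSum T β n R)] with x h1 h2
      rw [h1, Pi.smul_apply, h2]
      rfl
  filter_upwards [hsub, coeFn_weightedAverage T β f, coeFn_weightedAverage T β R] with x h1 h2 h3
  rintro ⟨n, -, hx⟩
  refine ⟨n, ?_⟩
  rcases Nat.eq_zero_or_pos n with rfl | hn
  · rw [h2, h3] at hx
    simp at hx
    linarith
  rw [h2, h3, ← mul_sub, norm_mul, norm_inv, Complex.norm_natCast,
    lt_inv_mul_iff₀ (by positivity)] at hx
  rw [enorm_eq_nnnorm, ENNReal.coe_lt_coe, ← NNReal.coe_lt_coe, coe_nnnorm, h1, norm_mul,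
    norm_inv, Complex.norm_real, Real.norm_of_nonneg hC0.le, lt_inv_mul_iff₀ hC0]
  refine lt_of_eq_of_lt ?_ hx
  push_cast
  rw [← hlε]
  ring

end Besicovitch

theorem theorem4p3 {Ω : Type*} [MeasurableSpace Ω] (μ : Measure Ω) [SigmaFinite μ]
    (T : Lp ℂ 1 μ →ₗ[ℂ] Lp ℂ 1 μ) (hT : IsDunfordSchwartz T)
    (β : ℕ → ℂ) (hβ : IsBoundedBesicovitch β) (f : Lp ℂ 1 μ) :
    ∃ g : Ω →ₘ[μ] ℂ,
      TendstoAU (fun n => ((weightedAverage T β n f : Lp ℂ 1 μ) : Ω →ₘ[μ] ℂ)) g :=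
  (hT.almostUniformCauchy_weightedAverage hβ f).exists_tendstoAU
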